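/- Let $\Gamma=\langle a,b,t\mid tat^{-1}=ab,\ tbt^{-1}=bab\rangle$ be the group of the figure eight knot and let $X=X(\Gamma,\mathrm{SL}(3,\mathbb C))$ be its variety of characters, with its Zariski topology (closed sets are the common zero sets of polynomials in the trace functions $\chi\mapsto\chi(\gamma)$, $\gamma\in\Gamma$). For $\chi\in X$ put $$y=\chi(t),\quad \bar y=\chi(t^{-1}),\quad z=\chi(ta^{-1}ta),\quad \bar z=\chi(a^{-1}t^{-1}at^{-1}),$$ $$\alpha=\chi(a),\quad \bar\alpha=\chi(a^{-1}),\quad \beta=\chi(b),\quad \bar\beta=\chi(b^{-1}),\quad \eta=\chi(aba^{-1}b^{-1}).$$ There is exactly one irreducible component of the Zariski closure of the set of irreducible characters in $X$ that lies over the plane $\beta=\bar\beta=1$; call it $V_2$. The map $\chi\mapsto(y,\bar y,z,\bar z,\alpha,\bar\alpha,\beta,\bar\beta)$ sends $V_2$ bijectively onto the set of all points of $\mathbb C^8$ that satisfy $$\beta=\bar\beta=1,\qquad y\bar y=\alpha+\bar\alpha+2,\qquad y^3+\bar y^3=\alpha\bar\alpha+5\alpha+5\bar\alpha+5,\qquad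 z=y^2-\bar y,\qquad \bar z=\bar y^2-y,$$ every character in $X$ whose coordinates satisfy these equations lies in $V_2$, and these equations generate the ideal of all polynomials in $\mathbb C[y,\bar y,z,\bar z,\alpha,\bar\alpha,\beta,\bar\beta]$ that vanish on $V_2$. Moreover, on $V_2$, $$\eta=\bar y^3-3(\alpha+\bar\alpha+1).$$ The coordinates of the characters of reducible representations in $V_2$ are exactly the three points $$(y,\bar y,z,\bar z,\alpha,\bar\alpha,\beta,\bar\beta)=(2\omega,2\omega^2,2\omega^2,2\omega,1,1,1,1),\qquad \omega^3=1,$$ that is, the orbit $\mu_3\cdot(2,2,2,2,1,1,1,1)$ under the centre $\mu_3$ of $\mathrm{SL}(3,\mathbb C)$; each of them is the character of a partially reducible representation, i.e. of the direct sum of a one-dimensional and an irreducible two-dimensional representation. -/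

import Mathlib

/-- The generators `a, b, t` of the figure eight knot group. -/
inductive FigEightGen : Type
  | a
  | b
  | t

/-- The relators of the presentation `⟨a, b, t ∣ t a t⁻¹ = a b, t b t⁻¹ = b a b⟩`. -/
def figEightRels : Set (FreeGroup FigEightGen) :=
  let a := FreeGroup.of FigEightGen.a
  let b := FreeGroup.of FigEightGen.b
  let t := FreeGroup.of FigEightGen.t
  {t * a * t⁻¹ * (a * b)⁻¹, t * b * t⁻¹ * (b * a * b)⁻¹}

/-- The fundamental group `Γ` of the figure eight knot complement, as the group of a punctured
torus bundle over the circle. -/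
abbrev FigEight : Type := PresentedGroup figEightRels

namespace FigEight

/-- The generator `a` of the fibre group. -/
def a : FigEight := PresentedGroup.of FigEightGen.a

/-- The generator `b` of the fibre group. -/
def b : FigEight := PresentedGroup.of FigEightGen.b

/-- The meridian `t`. -/
def t : FigEight := PresentedGroup.of FigEightGen.t

/-- Representations of `Γ` in `SL(3, ℂ)`. -/
abbrev Rep3 : Type := FigEight →* Matrix.SpecialLinearGroup (Fin 3) ℂ

/-- The linear representation of `Γ` on `ℂ³` given by a homomorphism to `SL(3, ℂ)`. -/
noncomputable def Rep3.toLinear (ρ : Rep3) : Representation ℂ FigEight (Fin 3 → ℂ) :=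
  (LinearEquiv.automorphismGroup.toLinearMapMonoidHom
    (R := ℂ) (M := Fin 3 → ℂ)).comp (Matrix.SpecialLinearGroup.toLin'.comp ρ)

/-- `ρ` leaves no proper nonzero subspace of `ℂ³` invariant. -/
def Rep3.IsIrred (ρ : Rep3) : Prop := Representation.IsIrreducible ρ.toLinear

/-- `ρ` is the direct sum of a one-dimensional representation and an irreducible two-dimensional
representation. -/
def Rep3.IsPartiallyReducible (ρ : Rep3) : Prop :=
  ∃ (l : Representation ℂ FigEight ℂ) (σ : Representation ℂ FigEight (Fin 2 → ℂ)),
    Representation.IsIrreducible σ ∧ Nonempty (Representation.Equiv ρ.toLinear (l.prod σ))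

/-- The character `γ ↦ tr (ρ γ)`. -/
def Rep3.char (ρ : Rep3) : FigEight → ℂ := fun γ => Matrix.trace (ρ γ).1

/-- The points of the variety of characters `X(Γ, SL(3, ℂ))`: the characters of the
representations of `Γ` in `SL(3, ℂ)`. -/
def CharVariety : Type := {χ : FigEight → ℂ // ∃ ρ : Rep3, ρ.char = χ}

namespace CharVariety

/-- The value `χ(γ)` of a character. -/
def tr (χ : CharVariety) (γ : FigEight) : ℂ := χ.1 γ

/-- The set of characters at which all the given polynomials in the trace functions
`χ ↦ χ(γ)`, `γ ∈ Γ`, vanish. -/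
def zeros (P : Set (MvPolynomial FigEight ℂ)) : Set CharVariety :=
  {χ | ∀ p ∈ P, MvPolynomial.eval χ.tr p = 0}

/-- The Zariski topology: the regular functions on the variety of characters are the polynomials
in the trace functions, and the closed sets are the zero sets of families of regular functions. -/
instance : TopologicalSpace CharVariety :=
  TopologicalSpace.ofClosed (Set.range zeros)
    ⟨{1}, by ext χ; simp [zeros]⟩
    (by
      intro A hA
      have hA' : ∀ Z ∈ A, ∃ P, zeros P = Z := fun Z hZ => hA hZ
      choose! P hP using hA'
      refine ⟨{p | ∃ Z ∈ A, p ∈ P Z}, ?_⟩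
      ext χ
      simp only [zeros, Set.mem_ofPred_eq, Set.mem_sInter]
      constructor
      · intro h Z hZ
        rw [← hP Z hZ]
        exact fun p hp => h p ⟨Z, hZ, hp⟩
      · rintro h p ⟨Z, hZ, hp⟩
        have := h Z hZ
        rw [← hP Z hZ] at this
        exact this p hp)
    (by
      rintro _ ⟨P, rfl⟩ _ ⟨Q, rfl⟩
      refine ⟨{r | ∃ p ∈ P, ∃ q ∈ Q, r = p * q}, ?_⟩
      ext χ
      simp only [zeros, Set.mem_ofPred_eq, Set.mem_union]
      constructor
      · intro h
        by_contra! hc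
        obtain ⟨⟨p, hp, hp0⟩, ⟨q, hq, hq0⟩⟩ := hc
        have := h _ ⟨p, hp, q, hq, rfl⟩
        rw [map_mul] at this
        exact (mul_ne_zero hp0 hq0) this
      · rintro (h | h) _ ⟨p, hp, q, hq, rfl⟩
        · rw [map_mul, h p hp, zero_mul]
        · rw [map_mul, h q hq, mul_zero])

/-- `χ` is the character of an irreducible representation. -/
def IsIrred (χ : CharVariety) : Prop := ∃ ρ : Rep3, ρ.IsIrred ∧ ρ.char = χ.1

/-- `χ` is the character of a reducible representation. -/
def IsReducible (χ : CharVariety) : Prop := ∃ ρ : Rep3, ¬ ρ.IsIrred ∧ ρ.char = χ.1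

/-- `χ` is the character of a partially reducible representation. -/
def IsPartiallyReducible (χ : CharVariety) : Prop :=
  ∃ ρ : Rep3, ρ.IsPartiallyReducible ∧ ρ.char = χ.1

/-- The coordinates `(y, ȳ, z, z̄, α, ᾱ, β, β̄) ∈ ℂ⁸` of a character. -/
def coords (χ : CharVariety) : Fin 8 → ℂ :=
  ![χ.tr t, χ.tr t⁻¹, χ.tr (t * a⁻¹ * t * a), χ.tr (a⁻¹ * t⁻¹ * a * t⁻¹),
    χ.tr a, χ.tr a⁻¹, χ.tr b, χ.tr b⁻¹]

/-- The trace `η` of the commutator `[a, b] = a b a⁻¹ b⁻¹`. -/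
def eta (χ : CharVariety) : ℂ := χ.tr (a * b * a⁻¹ * b⁻¹)

/-- `V` is an irreducible component of the Zariski closure of the set of irreducible characters. -/
def IsIrredComponent (V : Set CharVariety) : Prop :=
  Maximal (fun Z : Set CharVariety => IsIrreducible Z ∧ Z ⊆ closure {χ | χ.IsIrred}) V

/-- `V` is a component of the closure of the set of irreducible characters whose restriction to
the fibre group `⟨a, b⟩` lies over the plane `{(α, ᾱ, β, β̄) ∣ β = β̄ = 1}`.
This is what singles out the component `V₂`. -/
def IsV2 (V : Set CharVariety) : Prop :=
  IsIrredComponent V ∧ ∀ χ ∈ V, χ.tr b = 1 ∧ χ.tr b⁻¹ = 1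

end CharVariety

end FigEight

/-- The action of a cube root of unity `w` (an element of the centre of `SL(3, ℂ)`) on characters,
in the coordinates `(y, ȳ, z, z̄, α, ᾱ, β, β̄)`. -/
def centerAct (w : ℂ) (p : Fin 8 → ℂ) : Fin 8 → ℂ :=
  ![w * p 0, w ^ 2 * p 1, w ^ 2 * p 2, w * p 3, p 4, p 5, p 6, p 7]

/-! Put k = t b⁻¹. Over the plane β = β̄ = 1 Cayley-Hamilton gives b⁴ = 1, and z = y² - ȳ + χ(k⁻¹),
z̄ = ȳ² - y + χ(k). The last two equations of the surface thus say that k and k⁻¹ have trace 0. It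
follows that k³ = (k⁻¹b)³ = 1, and the representation factors through a triangle group; conversely a
pair of matrices with these traces defines a representation of Γ (`IsTrianglePair.rep`).

Conjugate k to diag(1, ω, ω²). The trace conditions express the diagonal entries of b and the
products b_ij b_ji through y and ȳ. Two invariants remain, the 3-cycles u and v of b: their sum is
fixed by det b = 1, their product is the product of the 2-cycles. As α and ᾱ are affine in u and v,
these two constraints become the two equations between y, ȳ, α, ᾱ (`tr_equations_of_diagOmega`). All
solutions occur (`exists_isTrianglePair_diagOmega`), and all traces are polynomials in the cycles
(`exists_trace_polynomial`), so the coordinates are bijective.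

The surface is a double cover of the (y, ȳ)-plane whose discriminant is not a square. This makes the
ideal of the equations prime and equal to the vanishing ideal (`mem_surfaceIdeal_iff`,
`mem_or_mem_of_mul_mem`).

An irreducible representation over the plane lies on the surface (`mem_componentV2_of_isIrred`): for
P = b²t the matrix P³ = (Pb)³ is scalar by Schur's lemma. If neither P nor Pb had the traces 0
wanted for k, each would have an eigenspace of dimension at least 2, and a common eigenvector would
span an invariant line. The remaining irreducible characters lie in two closed sets that do not
contain the surface, so the surface is a component; it is the only one over the plane because the
character variety is Noetherian.

A subspace invariant under diag(1, ω, ω²) is spanned by coordinate vectors, so for a reducible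
representation two of the three 2-cycles of b vanish. This leaves three points, realised through the
binary tetrahedral group. -/

namespace FigEight

/-- The group `SL(3, ℂ)`. -/
abbrev SL3 : Type := Matrix.SpecialLinearGroup (Fin 3) ℂ

/-! ### Traces and Cayley-Hamilton identities in SL(3, ℂ). -/

namespace SL3

/-- The trace of an element of `SL(3, ℂ)`. -/
def tr (M : SL3) : ℂ := Matrix.trace M.1

theorem tr_mul_comm (M N : SL3) : tr (M * N) = tr (N * M) := by
  rw [tr, tr, Matrix.SpecialLinearGroup.coe_mul, Matrix.SpecialLinearGroup.coe_mul,
    Matrix.trace_mul_comm]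

theorem tr_conj (M N : SL3) : tr (M * N * M⁻¹) = tr N := by
  rw [tr_mul_comm, inv_mul_cancel_left]

theorem tr_eq_of_conj {M N : SL3} (g : SL3) (h : M = g * N * g⁻¹) : tr M = tr N := by
  rw [h, tr_conj]

theorem tr_fin (M : SL3) : tr M = M.1 0 0 + M.1 1 1 + M.1 2 2 := Matrix.trace_fin_three _

theorem det_fin (M : SL3) :
    M.1 0 0 * M.1 1 1 * M.1 2 2 - M.1 0 0 * M.1 1 2 * M.1 2 1 - M.1 0 1 * M.1 1 0 * M.1 2 2
      + M.1 0 1 * M.1 1 2 * M.1 2 0 + M.1 0 2 * M.1 1 0 * M.1 2 1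
      - M.1 0 2 * M.1 1 1 * M.1 2 0 = 1 := by
  rw [← Matrix.det_fin_three, M.2]

/-- The Cayley-Hamilton theorem in `SL(3, ℂ)`. -/
theorem mul_self_eq (M : SL3) : M.1 * M.1 = tr M • M.1 - tr M⁻¹ • 1 + (M⁻¹).1 := by
  ext i j
  fin_cases i <;> fin_cases j <;>
    simp [tr, Matrix.trace_fin_three, Matrix.adjugate_fin_three, Matrix.mul_apply,
      Fin.sum_univ_three, Matrix.smul_apply] <;> ring

theorem tr_mul_self_mul (M N : SL3) :
    tr (M * M * N) = tr M * tr (M * N) - tr M⁻¹ * tr N + tr (M⁻¹ * N) := by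
  have h := congrArg (fun A => Matrix.trace (A * N.1)) (mul_self_eq M)
  simp only [add_mul, sub_mul, smul_mul_assoc, one_mul, Matrix.trace_add, Matrix.trace_sub,
    Matrix.trace_smul, smul_eq_mul] at h
  simpa only [tr, Matrix.SpecialLinearGroup.coe_mul] using h

theorem mul_self_eq_inv {M : SL3} (h : tr M = 0) (h' : tr M⁻¹ = 0) : M * M = M⁻¹ := by
  apply Subtype.ext
  simpa [h, h'] using! mul_self_eq M

theorem pow_three_eq_one {M : SL3} (h : tr M = 0) (h' : tr M⁻¹ = 0) : M ^ 3 = 1 := by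
  rw [pow_succ, pow_two, mul_self_eq_inv h h', inv_mul_cancel]

theorem mul_self_eq_sub {M : SL3} (h : tr M = 1) (h' : tr M⁻¹ = 1) :
    M.1 * M.1 = M.1 - 1 + (M⁻¹).1 := by
  simpa [h, h'] using mul_self_eq M

theorem pow_four_eq_one {M : SL3} (h : tr M = 1) (h' : tr M⁻¹ = 1) : M ^ 4 = 1 := by
  have h2 := mul_self_eq_sub h h'
  have h1 : M.1 * (M⁻¹).1 = 1 := by
    rw [← Matrix.SpecialLinearGroup.coe_mul, mul_inv_cancel, Matrix.SpecialLinearGroup.coe_one]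
  have h3 : M.1 * M.1 * M.1 = (M⁻¹).1 := by
    rw [mul_assoc, h2, mul_add, mul_sub, h1, mul_one, h2]
    abel
  apply Subtype.ext
  rw [Matrix.SpecialLinearGroup.coe_pow, Matrix.SpecialLinearGroup.coe_one, pow_succ', pow_succ,
    pow_two, h3, h1]

end SL3

open SL3

/-! ### Trace identities forced by the relations of the group. -/

section Relations

variable {A B T : SL3}

theorem inv_mul_mul_of_relation (h : T * A * T⁻¹ = A * B) : A⁻¹ * T * A = B * T := by
  rw [mul_inv_eq_iff_eq_mul] at h
  rw [mul_assoc, h]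
  group

theorem tr_product_of_relations (h : T * A * T⁻¹ = A * B) : tr (A * B) = tr A := by
  rw [← h, tr_conj]

theorem tr_inv_product_of_relations (h : T * A * T⁻¹ = A * B) : tr (A * B)⁻¹ = tr A⁻¹ := by
  rw [← h]
  exact tr_eq_of_conj T (by group)

/-- Conjugation by t⁻¹ inverts the monodromy: it sends b to ba⁻¹ and a to a²b⁻¹. -/
theorem tr_mul_inv_of_relations (h : T * A * T⁻¹ = A * B) (h' : T * B * T⁻¹ = B * A * B) :
    tr (B * A⁻¹) = tr B ∧ tr (A * B⁻¹) = tr B⁻¹ ∧ tr (A * A * B⁻¹) = tr A ∧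
      tr (B * A⁻¹ * A⁻¹) = tr A⁻¹ ∧ tr (B * A * B) = tr B ∧ tr (B * A * B)⁻¹ = tr B⁻¹ := by
  have hA : T⁻¹ * (A * B) * T = A := by rw [← h]; group
  have hB : T⁻¹ * (B * A * B) * T = B := by rw [← h']; group
  have e1 : B * A⁻¹ = T⁻¹ * B * T := by
    calc B * A⁻¹ = (T⁻¹ * (B * A * B) * T) * (T⁻¹ * (A * B) * T)⁻¹ := by rw [hA, hB]
      _ = T⁻¹ * B * T := by group
  have e2 : A * A * B⁻¹ = T⁻¹ * A * T := by
    calc A * A * B⁻¹ = (T⁻¹ * (A * B) * T) * (T⁻¹ * (A * B) * T) *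
          (T⁻¹ * (B * A * B) * T)⁻¹ := by rw [hA, hB]
      _ = T⁻¹ * A * T := by group
  refine ⟨?_, ?_, ?_, ?_, ?_, ?_⟩
  · exact tr_eq_of_conj T⁻¹ (by rw [e1, inv_inv])
  · refine tr_eq_of_conj T⁻¹ ?_
    rw [inv_inv, ← inv_inj, mul_inv_rev, inv_inv, e1]
    group
  · exact tr_eq_of_conj T⁻¹ (by rw [e2, inv_inv])
  · refine tr_eq_of_conj T⁻¹ ?_
    rw [inv_inv, ← inv_inj, mul_inv_rev, mul_inv_rev, inv_inv, ← mul_assoc, e2]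
    group
  · rw [← h', tr_conj]
  · rw [← h']
    exact tr_eq_of_conj T (by group)

/-- The equations satisfied by the traces of every representation. -/
theorem trace_equations (h : T * A * T⁻¹ = A * B) (h' : T * B * T⁻¹ = B * A * B) :
    (tr A - 1) * (tr B - tr B⁻¹) = 0 ∧ (tr A⁻¹ - 1) * (tr B - tr B⁻¹) = 0 ∧
      (tr A - tr A⁻¹) * (tr B⁻¹ - 1) = 0 ∧ (tr A - tr A⁻¹) * (tr B - 1) = 0 := by
  obtain ⟨h1, h2, h3, h4, h5, h6⟩ := tr_mul_inv_of_relations h h'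
  have h7 := tr_product_of_relations h
  have h8 := tr_inv_product_of_relations h
  -- In each of the four instances of Cayley-Hamilton every word is conjugate, possibly through t,
  -- to one of a, b and their inverses.
  have c1 := tr_mul_self_mul B A
  have c2 := tr_mul_self_mul B⁻¹ A⁻¹
  have c3 := tr_mul_self_mul A B⁻¹
  have c4 := tr_mul_self_mul A⁻¹ B
  rw [tr_mul_comm B A, h7, tr_mul_comm B⁻¹ A, h2,
    tr_eq_of_conj B (show B * B * A = B * (B * A * B) * B⁻¹ by group), h5] at c1
  rw [← mul_inv_rev A B, h8, inv_inv, h1,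
    tr_eq_of_conj B⁻¹ (show B⁻¹ * B⁻¹ * A⁻¹ = B⁻¹ * (B * A * B)⁻¹ * B⁻¹⁻¹ by group), h6] at c2
  rw [h3, h2, ← mul_inv_rev, tr_eq_of_conj B (show (B * A)⁻¹ = B * (A * B)⁻¹ * B⁻¹ by group),
    h8] at c3
  rw [tr_eq_of_conj (A⁻¹ * A⁻¹)
    (show A⁻¹ * A⁻¹ * B = A⁻¹ * A⁻¹ * (B * A⁻¹ * A⁻¹) * (A⁻¹ * A⁻¹)⁻¹ by group), h4,
    tr_mul_comm A⁻¹ B, h1, inv_inv, h7] at c4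
  refine ⟨?_, ?_, ?_, ?_⟩
  · linear_combination -c1
  · linear_combination c2
  · linear_combination -c3
  · linear_combination c4

theorem tr_inv_mul_inv_of_relation (h : T * A * T⁻¹ = A * B) :
    tr (B * T) = tr T ∧ tr (T⁻¹ * B⁻¹) = tr T⁻¹ := by
  have h1 := inv_mul_mul_of_relation h
  constructor
  · rw [← h1]
    exact tr_eq_of_conj A⁻¹ (by group)
  · rw [← mul_inv_rev, ← h1]
    exact tr_eq_of_conj A⁻¹ (by group)

/-- Since a⁻¹ta = bt, the two words are tbt and its analogue for t⁻¹, to which Cayley-Hamilton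
applies after cyclic permutation. The lemma turns the equations for z and z̄ into the vanishing of
the traces of tb⁻¹ and its inverse. -/
theorem tr_meridian_product (h : T * A * T⁻¹ = A * B) (hB : tr B = 1) (hB' : tr B⁻¹ = 1) :
    tr (T * A⁻¹ * T * A) = tr T ^ 2 - tr T⁻¹ + tr (T * B⁻¹)⁻¹ ∧
      tr (A⁻¹ * T⁻¹ * A * T⁻¹) = tr T⁻¹ ^ 2 - tr T + tr (T * B⁻¹) := by
  have h1 := inv_mul_mul_of_relation h
  obtain ⟨h2, h3⟩ := tr_inv_mul_inv_of_relation h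
  constructor
  · have e : T * A⁻¹ * T * A = T * (B * T) := by rw [← h1]; group
    rw [e, tr_eq_of_conj T⁻¹ (show T * (B * T) = T⁻¹ * (T * T * B) * T⁻¹⁻¹ by group),
      tr_mul_self_mul, tr_mul_comm T B, h2, hB, tr_mul_comm T⁻¹ B, mul_inv_rev, inv_inv]
    ring
  · have e : A⁻¹ * T⁻¹ * A * T⁻¹ = (B * T)⁻¹ * T⁻¹ := by rw [← h1]; group
    rw [e, tr_eq_of_conj T (show (B * T)⁻¹ * T⁻¹ = T * (T⁻¹ * T⁻¹ * B⁻¹) * T⁻¹ by group),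
      tr_mul_self_mul, h3, hB', inv_inv]
    ring

end Relations

/-! ### Pairs of matrices generating a triangle group, and their representations of Γ. -/

/-- The traces of the generators `k` and `b` of a representation of the triangle group
`⟨k, b ∣ k³, b⁴, (k⁻¹b)³⟩` of the kind that occurs on the component `V₂`. -/
structure IsTrianglePair (K B : SL3) : Prop where
  tr_left : tr K = 0
  tr_left_inv : tr K⁻¹ = 0
  tr_right : tr B = 1
  tr_right_inv : tr B⁻¹ = 1
  tr_inv_mul : tr (K⁻¹ * B) = 0
  tr_inv_mul' : tr (B⁻¹ * K) = 0

theorem isTrianglePair_of_relation {A B T : SL3} (h : T * A * T⁻¹ = A * B) (hB : tr B = 1)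
    (hB' : tr B⁻¹ = 1) (hK : tr (T * B⁻¹) = 0) (hK' : tr (T * B⁻¹)⁻¹ = 0) :
    IsTrianglePair (T * B⁻¹) B := by
  obtain ⟨h2, h3⟩ := tr_inv_mul_inv_of_relation h
  refine ⟨hK, hK', hB, hB', ?_, ?_⟩
  · rw [tr_eq_of_conj B⁻¹ (show (T * B⁻¹)⁻¹ * B = B⁻¹ * (B * B * T⁻¹) * B⁻¹⁻¹ by group),
      tr_mul_self_mul, hB, hB', tr_mul_comm B⁻¹, h3]
    rw [mul_inv_rev, inv_inv] at hK'
    rw [hK']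
    ring
  · rw [tr_eq_of_conj B (show B⁻¹ * (T * B⁻¹) = B * (B⁻¹ * B⁻¹ * T) * B⁻¹ by group),
      tr_mul_self_mul, inv_inv, hB, hB', h2, tr_mul_comm B⁻¹ T, hK]
    ring

namespace IsTrianglePair

variable {K B : SL3}

theorem right_pow (h : IsTrianglePair K B) : B ^ 4 = 1 := pow_four_eq_one h.tr_right h.tr_right_inv

theorem inv_mul_pow (h : IsTrianglePair K B) : (K⁻¹ * B) ^ 3 = 1 :=
  pow_three_eq_one h.tr_inv_mul (by rw [mul_inv_rev, inv_inv, h.tr_inv_mul'])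

/-- This is (k⁻¹b)³ = 1 rewritten; it is the form in which that relation enters the word
computations. -/
theorem braid (h : IsTrianglePair K B) : B * K⁻¹ * B = K * B⁻¹ * K := by
  have h1 := h.inv_mul_pow
  rw [pow_succ, pow_two, mul_eq_one_iff_eq_inv] at h1
  calc B * K⁻¹ * B = K * ((K⁻¹ * B) * (K⁻¹ * B)) := by group
    _ = K * B⁻¹ * K := by rw [h1]; group

theorem left_mul_self (h : IsTrianglePair K B) : K * K = K⁻¹ := mul_self_eq_inv h.tr_left h.tr_left_inv

theorem conj (h : IsTrianglePair K B) (g : SL3) : IsTrianglePair (g * K * g⁻¹) (g * B * g⁻¹) := by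
  refine ⟨?_, ?_, ?_, ?_, ?_, ?_⟩
  · rw [tr_conj, h.tr_left]
  · rw [tr_eq_of_conj g (show (g * K * g⁻¹)⁻¹ = g * K⁻¹ * g⁻¹ by group), h.tr_left_inv]
  · rw [tr_conj, h.tr_right]
  · rw [tr_eq_of_conj g (show (g * B * g⁻¹)⁻¹ = g * B⁻¹ * g⁻¹ by group), h.tr_right_inv]
  · rw [tr_eq_of_conj g (show (g * K * g⁻¹)⁻¹ * (g * B * g⁻¹) = g * (K⁻¹ * B) * g⁻¹ by group),
      h.tr_inv_mul]
  · rw [tr_eq_of_conj g (show (g * B * g⁻¹)⁻¹ * (g * K * g⁻¹) = g * (B⁻¹ * K) * g⁻¹ by group),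
      h.tr_inv_mul']

end IsTrianglePair

theorem t_mul_a : t * a * t⁻¹ = a * b := by
  have h : (PresentedGroup.mk figEightRels) (FreeGroup.of .t * .of .a * (FreeGroup.of .t)⁻¹ *
      (.of .a * .of .b)⁻¹) = 1 :=
    PresentedGroup.one_of_mem (by simp [figEightRels])
  rw [map_mul, map_inv, mul_inv_eq_one] at h
  simpa [a, b, t, PresentedGroup.of] using h

theorem t_mul_b : t * b * t⁻¹ = b * a * b := by
  have h : (PresentedGroup.mk figEightRels) (FreeGroup.of .t * .of .b * (FreeGroup.of .t)⁻¹ *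
      (.of .b * .of .a * .of .b)⁻¹) = 1 :=
    PresentedGroup.one_of_mem (by simp [figEightRels])
  rw [map_mul, map_inv, mul_inv_eq_one] at h
  simpa [a, b, t, PresentedGroup.of] using h

theorem a_eq : a = b⁻¹ * t * b * t⁻¹ * b⁻¹ := by
  have h : b⁻¹ * (t * b * t⁻¹) * b⁻¹ = a := by rw [t_mul_b]; group
  rw [← h]
  group

theorem closure_eq_top : Subgroup.closure {b, t} = (⊤ : Subgroup FigEight) := by
  rw [eq_top_iff, ← PresentedGroup.closure_range_of figEightRels, Subgroup.closure_le]
  have hb : b ∈ Subgroup.closure ({b, t} : Set FigEight) := Subgroup.subset_closure (by simp)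
  have ht : t ∈ Subgroup.closure ({b, t} : Set FigEight) := Subgroup.subset_closure (by simp)
  rintro _ ⟨_ | _ | _, rfl⟩
  · change a ∈ _
    rw [a_eq]
    exact mul_mem (mul_mem (mul_mem (mul_mem (inv_mem hb) ht) hb) (inv_mem ht)) (inv_mem hb)
  · exact hb
  · exact ht

/-- A homomorphism out of the figure eight knot group is determined by the images of `b`, `t`. -/
theorem hom_ext {G : Type*} [Group G] {f g : FigEight →* G} (hb : f b = g b) (ht : f t = g t) :
    f = g :=
  MonoidHom.eq_of_eqOn_dense closure_eq_top (by rintro _ (rfl | rfl) <;> assumption)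

/-- The homomorphism given by images of the generators that satisfy the relations. -/
def lift {G : Type*} [Group G] (A B T : G) (h : T * A * T⁻¹ = A * B)
    (h' : T * B * T⁻¹ = B * A * B) : FigEight →* G :=
  PresentedGroup.toGroup (f := fun | .a => A | .b => B | .t => T) (by
    rintro r (rfl | rfl)
    · simp [h]
    · simp [h'])

section lift

variable {G : Type*} [Group G] {A B T : G} (h : T * A * T⁻¹ = A * B) (h' : T * B * T⁻¹ = B * A * B)

@[simp] theorem lift_a : lift A B T h h' a = A := PresentedGroup.toGroup.of _
@[simp] theorem lift_b : lift A B T h h' b = B := PresentedGroup.toGroup.of _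
@[simp] theorem lift_t : lift A B T h h' t = T := PresentedGroup.toGroup.of _

end lift

/-- The representation of `Γ` that factors through the triangle group. -/
noncomputable def IsTrianglePair.rep {K B : SL3} (h : IsTrianglePair K B) : Rep3 :=
  lift (B⁻¹ * K * B * K⁻¹ * B⁻¹) B (K * B)
    (calc K * B * (B⁻¹ * K * B * K⁻¹ * B⁻¹) * (K * B)⁻¹
        = (K * K) * B * K⁻¹ * (B ^ 4)⁻¹ * B * B * K⁻¹ := by group
      _ = K⁻¹ * (B * K⁻¹ * B) * B * K⁻¹ := by rw [h.left_mul_self, h.right_pow]; group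
      _ = B⁻¹ * K * B * K⁻¹ * B⁻¹ * B := by rw [h.braid]; group)
    (by group)

namespace IsTrianglePair

variable {K B : SL3} (h : IsTrianglePair K B)

@[simp] theorem rep_b : h.rep b = B := lift_b _ _
@[simp] theorem rep_t : h.rep t = K * B := lift_t _ _
@[simp] theorem rep_a : h.rep a = B⁻¹ * K * B * K⁻¹ * B⁻¹ := lift_a _ _

/-- As t = kb, the commutator [a, b] equals t⁻³ in these representations, which yields the formula
for η. -/
theorem commutator_eq (h : IsTrianglePair K B) :
    (B⁻¹ * K * B * K⁻¹ * B⁻¹) * B * (B⁻¹ * K * B * K⁻¹ * B⁻¹)⁻¹ * B⁻¹ = ((B⁻¹ * K⁻¹) ^ 3) := by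
  calc _ = B⁻¹ * K * (B * K⁻¹ * B) * K * B⁻¹ * K⁻¹ := by group
    _ = B⁻¹ * (K * K) * B⁻¹ * (K * K) * B⁻¹ * K⁻¹ := by rw [h.braid]; group
    _ = _ := by rw [h.left_mul_self, pow_succ, pow_two]; group

end IsTrianglePair

/-! ### Cube roots of unity and the diagonal form of k. -/

/-- A primitive cube root of unity. -/
noncomputable def omega : ℂ := Complex.exp (2 * Real.pi * Complex.I / 3)

theorem isPrimitiveRoot_omega : IsPrimitiveRoot omega 3 :=
  Complex.isPrimitiveRoot_exp 3 (by norm_num)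

theorem omega_pow_three : omega ^ 3 = 1 := isPrimitiveRoot_omega.pow_eq_one

theorem omega_sq : omega ^ 2 = -1 - omega := by
  have h := isPrimitiveRoot_omega.geom_sum_eq_zero (by norm_num)
  simp only [Finset.sum_range_succ, Finset.sum_range_zero] at h
  linear_combination h

theorem omega_ne_zero : omega ≠ 0 := isPrimitiveRoot_omega.ne_zero (by norm_num)

theorem omega_ne_one : omega ≠ 1 := isPrimitiveRoot_omega.ne_one (by norm_num)

theorem omega_sq_ne_one : omega ^ 2 ≠ 1 :=
  isPrimitiveRoot_omega.pow_ne_one_of_pos_of_lt (by norm_num) (by norm_num)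

theorem two_mul_omega_add_one_ne_zero : 2 * omega + 1 ≠ 0 := by
  intro h
  -- The square of 2ω + 1 is -3.
  have h3 : (3 : ℂ) = 0 := by linear_combination 4 * omega_sq - (2 * omega + 1) * h
  norm_num at h3

theorem cube_eq_one_iff {w : ℂ} : w ^ 3 = 1 ↔ w = 1 ∨ w = omega ∨ w = omega ^ 2 := by
  constructor
  · intro h
    have h' : (w - 1) * ((w - omega) * (w - omega ^ 2)) = 0 := by
      have := omega_sq
      grind
    rcases mul_eq_zero.1 h' with h1 | h1
    · exact Or.inl (sub_eq_zero.1 h1)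
    · rcases mul_eq_zero.1 h1 with h1 | h1
      · exact Or.inr (Or.inl (sub_eq_zero.1 h1))
      · exact Or.inr (Or.inr (sub_eq_zero.1 h1))
  · rintro (rfl | rfl | rfl)
    · norm_num
    · exact omega_pow_three
    · rw [← pow_mul, mul_comm, pow_mul, omega_pow_three, one_pow]

/-- The diagonal matrix with entries `1, ω, ω²`. -/
noncomputable def diagOmega : SL3 :=
  ⟨Matrix.diagonal ![1, omega, omega ^ 2], by
    rw [Matrix.det_diagonal, Fin.prod_univ_three]
    simp [← pow_succ', omega_pow_three]⟩

theorem diagOmega_coe : diagOmega.1 = Matrix.diagonal ![1, omega, omega ^ 2] := rfl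

theorem diagOmega_inv_coe : (diagOmega⁻¹).1 = Matrix.diagonal ![1, omega ^ 2, omega] := by
  rw [Matrix.SpecialLinearGroup.coe_inv, diagOmega_coe]
  ext i j
  rw [Matrix.adjugate_fin_three]
  have := omega_pow_three
  fin_cases i <;> fin_cases j <;> simp [Matrix.diagonal]
  rw [← this]; ring

theorem exists_eq_conj_diagOmega {K : SL3} (h : tr K = 0) (h' : tr K⁻¹ = 0) :
    ∃ g : SL3, K = g * diagOmega * g⁻¹ := by
  have hK := mul_self_eq_inv h h'
  have hK2 : K.1 * K.1 = (K⁻¹).1 := by rw [← hK]; rfl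
  have hK3 : K.1 * (K⁻¹).1 = 1 := by
    rw [← Matrix.SpecialLinearGroup.coe_mul, mul_inv_cancel, Matrix.SpecialLinearGroup.coe_one]
  have key : ∀ z : ℂ, z ^ 3 = 1 → ∃ v : Fin 3 → ℂ, v ≠ 0 ∧ K.1.mulVec v = z • v := by
    intro z hz
    -- Up to the factor 3 this is the projection onto the z-eigenspace of K. Its trace is 3, so it
    -- has a nonzero column, which is an eigenvector.
    let E : Matrix (Fin 3) (Fin 3) ℂ := 1 + z ^ 2 • K.1 + z • (K⁻¹).1
    have hE : K.1 * E = z • E := by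
      simp only [E, mul_add, mul_one, mul_smul_comm, hK2, hK3, smul_add, smul_smul]
      rw [← pow_succ', hz, one_smul, ← pow_two]
      abel
    have hE0 : E ≠ 0 := by
      intro h0
      have h1 := congrArg Matrix.trace h0
      have h2 : Matrix.trace K.1 = 0 := h
      have h3 : Matrix.trace (K⁻¹).1 = 0 := h'
      rw [Matrix.trace_zero, Matrix.trace_add, Matrix.trace_add, Matrix.trace_smul,
        Matrix.trace_smul, h2, h3, Matrix.trace_one] at h1
      norm_num at h1
    obtain ⟨j, hj⟩ : ∃ j, E.col j ≠ 0 := by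
      by_contra! hc
      exact hE0 (by ext i j; exact congrFun (hc j) i)
    refine ⟨E.col j, hj, ?_⟩
    ext i
    have := congrFun (congrFun hE i) j
    simpa [Matrix.mulVec, dotProduct, Matrix.mul_apply, Matrix.col] using this
  have hz : ∀ i, (![1, omega, omega ^ 2] i) ^ 3 = 1 := by
    intro i
    fin_cases i
    · simp
    · simp [omega_pow_three]
    · exact cube_eq_one_iff.2 (by simp)
  choose v hv0 hv using fun i => key _ (hz i)
  have hli : LinearIndependent ℂ v := by
    refine Module.End.eigenvectors_linearIndependent' (Matrix.toLin' K.1)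
      ![1, omega, omega ^ 2] ?_ v fun i => ?_
    · have h1 := omega_ne_one
      have h2 := omega_sq_ne_one
      have h3 : omega ≠ omega ^ 2 := fun h => omega_ne_one (by
        have := omega_ne_zero
        rw [pow_two] at h
        exact (mul_eq_left₀ this).1 h.symm)
      intro i j
      fin_cases i <;> fin_cases j <;> simp [h1, h2, h3, h1.symm, h2.symm, h3.symm]
    · rw [Module.End.hasEigenvector_iff, Module.End.mem_eigenspace_iff, Matrix.toLin'_apply]
      exact ⟨hv i, hv0 i⟩
  let P : Matrix (Fin 3) (Fin 3) ℂ := Matrix.of fun i j => v j i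
  have hP : P.det ≠ 0 := by
    have : IsUnit P := Matrix.linearIndependent_cols_iff_isUnit.1 hli
    exact ((Matrix.isUnit_iff_isUnit_det _).1 this).ne_zero
  have hKP : K.1 * P = P * diagOmega.1 := by
    ext i j
    rw [diagOmega_coe, Matrix.mul_diagonal]
    have := congrFun (hv j) i
    simpa [Matrix.mulVec, dotProduct, Matrix.mul_apply, P, mul_comm] using this
  -- The matrix of eigenvectors is rescaled to have determinant 1.
  obtain ⟨c, hc⟩ := IsAlgClosed.exists_pow_nat_eq (P.det)⁻¹ (n := 3) (by norm_num)
  let g : SL3 := ⟨c • P, by rw [Matrix.det_smul, Fintype.card_fin, hc, inv_mul_cancel₀ hP]⟩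
  refine ⟨g, ?_⟩
  rw [eq_mul_inv_iff_mul_eq]
  apply Subtype.ext
  change K.1 * (c • P) = (c • P) * diagOmega.1
  rw [mul_smul_comm, hKP, smul_mul_assoc]

theorem tr_diagOmega_mul (M : SL3) :
    tr (diagOmega * M) = M.1 0 0 + omega * M.1 1 1 + omega ^ 2 * M.1 2 2 := by
  rw [tr_fin, Matrix.SpecialLinearGroup.coe_mul, diagOmega_coe]
  simp [Matrix.diagonal_mul]

theorem tr_diagOmega_inv_mul (M : SL3) :
    tr (diagOmega⁻¹ * M) = M.1 0 0 + omega ^ 2 * M.1 1 1 + omega * M.1 2 2 := by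
  rw [tr_fin, Matrix.SpecialLinearGroup.coe_mul, diagOmega_inv_coe]
  simp [Matrix.diagonal_mul]

theorem inv_coe_fin (M : SL3) : (M⁻¹).1 =
    !![M.1 1 1 * M.1 2 2 - M.1 1 2 * M.1 2 1,
      -(M.1 0 1 * M.1 2 2) + M.1 0 2 * M.1 2 1,
      M.1 0 1 * M.1 1 2 - M.1 0 2 * M.1 1 1;
      -(M.1 1 0 * M.1 2 2) + M.1 1 2 * M.1 2 0,
      M.1 0 0 * M.1 2 2 - M.1 0 2 * M.1 2 0,
      -(M.1 0 0 * M.1 1 2) + M.1 0 2 * M.1 1 0;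
      M.1 1 0 * M.1 2 1 - M.1 1 1 * M.1 2 0,
      -(M.1 0 0 * M.1 2 1) + M.1 0 1 * M.1 2 0,
      M.1 0 0 * M.1 1 1 - M.1 0 1 * M.1 1 0] := by
  rw [Matrix.SpecialLinearGroup.coe_inv, Matrix.adjugate_fin_three]

/-! ### The cycles of b as invariants, and the equations of the surface. -/

/-- The equations for the diagonal entries, the `2`-cycles and the `3`-cycles of a matrix `B`, with
`y, y'` the traces of `diag(1, ω, ω²) B` and of its inverse. -/
structure CycleEquations (B : Matrix (Fin 3) (Fin 3) ℂ) (y y' : ℂ) : Prop where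
  d0 : B 0 0 = (1 + y) / 3
  d1 : B 1 1 = (1 + omega ^ 2 * y) / 3
  d2 : B 2 2 = (1 + omega * y) / 3
  c0 : B 1 2 * B 2 1 = (-2 - y + (y ^ 2 - 3 * y')) / 9
  c1 : B 0 2 * B 2 0 = (-2 - omega ^ 2 * y + omega * (y ^ 2 - 3 * y')) / 9
  c2 : B 0 1 * B 1 0 = (-2 - omega * y + omega ^ 2 * (y ^ 2 - 3 * y')) / 9
  sum : B 0 1 * B 1 2 * B 2 0 + B 0 2 * B 2 1 * B 1 0 =
    1 + 2 * (1 + y ^ 3) / 27 - (1 + y * y') / 3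

/-- With D = diag(1, ω, ω²), the traces of B, DB and D⁻¹B are the discrete Fourier transform of the
diagonal of B. Those of B⁻¹, DB⁻¹ and D⁻¹B⁻¹ give in the same way the principal 2 × 2 minors, hence
the 2-cycles; the determinant then gives the sum of the 3-cycles. -/
theorem isTrianglePair_diagOmega_iff {B : SL3} :
    IsTrianglePair diagOmega B ↔
      CycleEquations B.1 (tr (diagOmega * B)) (tr (diagOmega * B)⁻¹) := by
  have hdet := det_fin B
  have hw := omega_sq
  have hw3 := omega_pow_three
  have t0 := tr_fin B
  have t1 := tr_diagOmega_mul B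
  have t2 := tr_diagOmega_inv_mul B
  have s0 := tr_fin B⁻¹
  have s1 := tr_diagOmega_mul B⁻¹
  have s2 := tr_diagOmega_inv_mul B⁻¹
  rw [tr_mul_comm, ← mul_inv_rev] at s2
  rw [tr_mul_comm] at s1
  rw [inv_coe_fin] at s0 s1 s2
  simp only [Matrix.of_apply, Matrix.cons_val] at s0 s1 s2
  set y := tr (diagOmega * B)
  set y' := tr (diagOmega * B)⁻¹
  constructor
  · rintro ⟨-, -, h1, h2, h3, h4⟩
    rw [t0] at h1
    rw [s0] at h2
    rw [t2] at h3
    rw [s1] at h4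
    have d0 : B.1 0 0 = (1 + y) / 3 := by grind
    have d1 : B.1 1 1 = (1 + omega ^ 2 * y) / 3 := by grind
    have d2 : B.1 2 2 = (1 + omega * y) / 3 := by grind
    have e0 : B.1 1 1 * B.1 2 2 - B.1 1 2 * B.1 2 1 = (1 + y') / 3 := by grind
    have e1 : B.1 0 0 * B.1 2 2 - B.1 0 2 * B.1 2 0 = (1 + omega * y') / 3 := by grind
    have e2 : B.1 0 0 * B.1 1 1 - B.1 0 1 * B.1 1 0 = (1 + omega ^ 2 * y') / 3 := by grind
    have c0 : B.1 1 2 * B.1 2 1 = (-2 - y + (y ^ 2 - 3 * y')) / 9 := by grind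
    have c1 : B.1 0 2 * B.1 2 0 = (-2 - omega ^ 2 * y + omega * (y ^ 2 - 3 * y')) / 9 := by grind
    have c2 : B.1 0 1 * B.1 1 0 = (-2 - omega * y + omega ^ 2 * (y ^ 2 - 3 * y')) / 9 := by grind
    refine ⟨d0, d1, d2, c0, c1, c2, ?_⟩
    have : B.1 0 1 * B.1 1 2 * B.1 2 0 + B.1 0 2 * B.1 2 1 * B.1 1 0 = 1 -
      B.1 0 0 * B.1 1 1 * B.1 2 2 + B.1 0 0 * (B.1 1 2 * B.1 2 1) + 
      B.1 2 2 * (B.1 0 1 * B.1 1 0) + B.1 1 1 * (B.1 0 2 * B.1 2 0) := by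
      linear_combination hdet
    rw [this, d0, d1, d2, c0, c1, c2]
    clear * - hw
    grind
  · rintro ⟨d0, d1, d2, c0, c1, c2, hs⟩
    have k0 : tr diagOmega = 0 := by
      have := tr_diagOmega_mul 1
      simp at this
      rw [this, omega_sq]; ring
    have k1 : tr diagOmega⁻¹ = 0 := by
      have := tr_diagOmega_inv_mul 1
      simp at this
      rw [this, omega_sq]; ring
    clear hdet hs
    refine ⟨k0, k1, ?_, ?_, ?_, ?_⟩
    · clear * - t0 d0 d1 d2 hw
      grind
    · clear * - s0 d0 d1 d2 c0 c1 c2 hw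
      rw [s0, c0, c1, c2, d0, d1, d2]
      grind
    · clear * - t2 d0 d1 d2 hw
      grind
    · clear * - s1 d0 d1 d2 c0 c1 c2 hw
      rw [s1, c0, c1, c2, d0, d1, d2]
      grind

theorem tr_mul_diagOmega_conj (M N : SL3) :
    tr (M * (diagOmega * N * diagOmega⁻¹)) =
      M.1 0 0 * N.1 0 0 + M.1 1 1 * N.1 1 1 + M.1 2 2 * N.1 2 2
        + omega * (M.1 0 1 * N.1 1 0 + M.1 1 2 * N.1 2 1 + M.1 2 0 * N.1 0 2)
        + omega ^ 2 * (M.1 1 0 * N.1 0 1 + M.1 2 1 * N.1 1 2 + M.1 0 2 * N.1 2 0) := by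
  have h := omega_sq
  simp only [tr_fin, Matrix.SpecialLinearGroup.coe_mul, diagOmega_coe, diagOmega_inv_coe,
    Matrix.mul_apply (M := M.1), Fin.sum_univ_three, Matrix.mul_diagonal, Matrix.diagonal_mul,
    Matrix.cons_val]
  grind

/-- A `3`-cycle of a matrix. -/
def cyclePos (B : Matrix (Fin 3) (Fin 3) ℂ) : ℂ := B 0 1 * B 1 2 * B 2 0

/-- The `3`-cycle of a matrix in the opposite direction. -/
def cycleNeg (B : Matrix (Fin 3) (Fin 3) ℂ) : ℂ := B 0 2 * B 2 1 * B 1 0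

namespace CycleEquations

variable {B : Matrix (Fin 3) (Fin 3) ℂ} {y y' : ℂ}

/-- The two 3-cycles together use each off-diagonal entry once, so their product is the product of
the three 2-cycles. -/
theorem cycle_mul (h : CycleEquations B y y') : cyclePos B * cycleNeg B =
    (-8 - y ^ 3 + (y ^ 2 - 3 * y') ^ 3 - 6 * y * (y ^ 2 - 3 * y')) / 729 := by
  have e : cyclePos B * cycleNeg B = (B 1 2 * B 2 1) * (B 0 2 * B 2 0) * (B 0 1 * B 1 0) := by
    simp only [cyclePos, cycleNeg]; ring
  have := omega_sq
  rw [e, h.c0, h.c1, h.c2]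
  clear * - this
  grind

end CycleEquations

theorem tr_diagOmega_rep_a {B : SL3} (h : IsTrianglePair diagOmega B) :
    tr (B⁻¹ * diagOmega * B * diagOmega⁻¹ * B⁻¹) =
      (1 + tr (diagOmega * B) ^ 3) / 9 + 3 * omega ^ 2 * cyclePos B.1 + 3 * omega * cycleNeg B.1 := by
  obtain ⟨d0, d1, d2, c0, c1, c2, hs⟩ := isTrianglePair_diagOmega_iff.1 h
  rw [tr_eq_of_conj B (show B⁻¹ * diagOmega * B * diagOmega⁻¹ * B⁻¹ =
    B * (B⁻¹ * B⁻¹ * (diagOmega * B * diagOmega⁻¹)) * B⁻¹ by group), tr_mul_self_mul, inv_inv,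
    h.tr_right, h.tr_right_inv, tr_conj, h.tr_right, tr_mul_diagOmega_conj, tr_mul_diagOmega_conj,
    inv_coe_fin]
  simp only [Matrix.of_apply, Matrix.cons_val, cyclePos, cycleNeg] at hs ⊢
  have := omega_sq
  generalize tr (diagOmega * B) = y at *
  generalize tr (diagOmega * B)⁻¹ = y' at *
  clear h
  grind

theorem tr_diagOmega_rep_a_inv {B : SL3} (h : IsTrianglePair diagOmega B) :
    tr (B⁻¹ * diagOmega * B * diagOmega⁻¹ * B⁻¹)⁻¹ =
      (1 + tr (diagOmega * B) ^ 3) / 9 + 3 * omega * cyclePos B.1 + 3 * omega ^ 2 * cycleNeg B.1 := by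
  obtain ⟨d0, d1, d2, c0, c1, c2, hs⟩ := isTrianglePair_diagOmega_iff.1 h
  rw [tr_eq_of_conj B⁻¹ (show (B⁻¹ * diagOmega * B * diagOmega⁻¹ * B⁻¹)⁻¹ =
    B⁻¹ * (B * B * (diagOmega * B⁻¹ * diagOmega⁻¹)) * B⁻¹⁻¹ by group), tr_mul_self_mul,
    h.tr_right, h.tr_right_inv, tr_conj, h.tr_right_inv, tr_mul_diagOmega_conj,
    tr_mul_diagOmega_conj, inv_coe_fin]
  simp only [Matrix.of_apply, Matrix.cons_val, cyclePos, cycleNeg] at hs ⊢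
  have := omega_sq
  generalize tr (diagOmega * B) = y at *
  generalize tr (diagOmega * B)⁻¹ = y' at *
  clear h
  grind

/-- The first equation is the formula for the sum of the 3-cycles, the second the formula for their
product, both rewritten in α and ᾱ. -/
theorem tr_equations_of_diagOmega {B : SL3} (h : IsTrianglePair diagOmega B) :
    tr (diagOmega * B) * tr (diagOmega * B)⁻¹ =
        tr (B⁻¹ * diagOmega * B * diagOmega⁻¹ * B⁻¹)
          + tr (B⁻¹ * diagOmega * B * diagOmega⁻¹ * B⁻¹)⁻¹ + 2 ∧
      tr (diagOmega * B) ^ 3 + tr (diagOmega * B)⁻¹ ^ 3 =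
        tr (B⁻¹ * diagOmega * B * diagOmega⁻¹ * B⁻¹)
            * tr (B⁻¹ * diagOmega * B * diagOmega⁻¹ * B⁻¹)⁻¹
          + 5 * tr (B⁻¹ * diagOmega * B * diagOmega⁻¹ * B⁻¹)
          + 5 * tr (B⁻¹ * diagOmega * B * diagOmega⁻¹ * B⁻¹)⁻¹ + 5 := by
  have hs := (isTrianglePair_diagOmega_iff.1 h).sum
  have hm := (isTrianglePair_diagOmega_iff.1 h).cycle_mul
  rw [tr_diagOmega_rep_a h, tr_diagOmega_rep_a_inv h]
  change cyclePos B.1 + cycleNeg B.1 = _ at hs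
  have := omega_sq
  generalize tr (diagOmega * B) = y at *
  generalize tr (diagOmega * B)⁻¹ = y' at *
  generalize cyclePos B.1 = u at *
  generalize cycleNeg B.1 = v at *
  clear h
  constructor <;> grind

theorem IsTrianglePair.exists_conj {K B : SL3} (h : IsTrianglePair K B) :
    ∃ g C : SL3, IsTrianglePair diagOmega C ∧ K = g * diagOmega * g⁻¹ ∧ B = g * C * g⁻¹ := by
  obtain ⟨g, hg⟩ := exists_eq_conj_diagOmega h.tr_left h.tr_left_inv
  refine ⟨g, g⁻¹ * B * g, ?_, hg, by group⟩
  have := h.conj g⁻¹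
  rwa [hg, inv_inv, show g⁻¹ * (g * diagOmega * g⁻¹) * g = diagOmega by group] at this

/-- The relation uv = c₀c₁c₂ is the only constraint on the cycles of a 3 × 3 matrix. If u or v is
nonzero, most off-diagonal entries can be normalised by diagonal conjugation; if both vanish, some
2-cycle vanishes too. -/
theorem exists_matrix_of_cycles {d0 d1 d2 c0 c1 c2 u v : ℂ} (h : u * v = c0 * c1 * c2) :
    ∃ M : Matrix (Fin 3) (Fin 3) ℂ, M 0 0 = d0 ∧ M 1 1 = d1 ∧ M 2 2 = d2 ∧
      M 1 2 * M 2 1 = c0 ∧ M 0 2 * M 2 0 = c1 ∧ M 0 1 * M 1 0 = c2 ∧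
      cyclePos M = u ∧ cycleNeg M = v := by
  by_cases hu : u = 0
  · by_cases hv : v = 0
    · have hc : c0 * c1 * c2 = 0 := by rw [← h, hu, zero_mul]
      rcases mul_eq_zero.1 hc with hc | hc
      · rcases mul_eq_zero.1 hc with hc | hc
        · exact ⟨!![d0, 1, 1; c2, d1, 0; c1, 0, d2], by simp [cyclePos, cycleNeg, *]⟩
        · exact ⟨!![d0, 1, 0; c2, d1, 1; 0, c0, d2], by simp [cyclePos, cycleNeg, *]⟩
      · exact ⟨!![d0, 0, 1; 0, d1, 1; c1, c0, d2], by simp [cyclePos, cycleNeg, *]⟩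
    · refine ⟨!![d0, c2, v; 1, d1, c0; c1 / v, 1, d2], ?_⟩
      simp only [cyclePos, cycleNeg, Matrix.of_apply, Matrix.cons_val]
      refine ⟨trivial, trivial, trivial, by ring, by field_simp, by ring, ?_, by ring⟩
      field_simp
      linear_combination -h
  · refine ⟨!![d0, 1, c1 / u; c2, d1, 1; u, c0, d2], ?_⟩
    simp only [cyclePos, cycleNeg, Matrix.of_apply, Matrix.cons_val]
    refine ⟨trivial, trivial, trivial, by ring, by field_simp, by ring, by ring, ?_⟩
    field_simp
    linear_combination -h

theorem CycleEquations.det_eq_one {B : Matrix (Fin 3) (Fin 3) ℂ} {y y' : ℂ}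
    (h : CycleEquations B y y') : B.det = 1 := by
  obtain ⟨d0, d1, d2, c0, c1, c2, hs⟩ := h
  have e : B.det = B 0 0 * B 1 1 * B 2 2 - B 0 0 * (B 1 2 * B 2 1) - B 2 2 * (B 0 1 * B 1 0)
      - B 1 1 * (B 0 2 * B 2 0) + (B 0 1 * B 1 2 * B 2 0 + B 0 2 * B 2 1 * B 1 0) := by
    rw [Matrix.det_fin_three]; ring
  have := omega_sq
  rw [e, hs, c0, c1, c2, d0, d1, d2]
  clear * - this
  grind

theorem CycleEquations.tr_eq {B : SL3} {y y' : ℂ} (h : CycleEquations B.1 y y') :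
    tr (diagOmega * B) = y ∧ tr (diagOmega * B)⁻¹ = y' := by
  obtain ⟨d0, d1, d2, c0, c1, c2, -⟩ := h
  have hw := omega_sq
  rw [mul_inv_rev, tr_mul_comm B⁻¹, tr_diagOmega_mul, tr_diagOmega_inv_mul, inv_coe_fin]
  simp only [Matrix.of_apply, Matrix.cons_val]
  rw [c0, c1, c2, d0, d1, d2]
  clear * - hw
  constructor <;> grind

theorem exists_isTrianglePair_diagOmega {y y' α α' : ℂ} (h1 : y * y' = α + α' + 2)
    (h2 : y ^ 3 + y' ^ 3 = α * α' + 5 * α + 5 * α' + 5) :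
    ∃ B : SL3, IsTrianglePair diagOmega B ∧ tr (diagOmega * B) = y ∧
      tr (diagOmega * B)⁻¹ = y' ∧ tr (B⁻¹ * diagOmega * B * diagOmega⁻¹ * B⁻¹) = α ∧
      tr (B⁻¹ * diagOmega * B * diagOmega⁻¹ * B⁻¹)⁻¹ = α' := by
  have hw := omega_sq
  let g : ℂ := 1 + 2 * (1 + y ^ 3) / 27 - (1 + y * y') / 3
  let f : ℂ := (1 + y ^ 3) / 9
  -- The 3-cycles solve the system u + v = g, α = f + 3ω²u + 3ωv, ᾱ = f + 3ωu + 3ω²v, again by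
  -- Fourier inversion.
  let u : ℂ := (omega * α + omega ^ 2 * α' + f + 3 * g) / 9
  let v : ℂ := (omega ^ 2 * α + omega * α' + f + 3 * g) / 9
  obtain ⟨M, d0, d1, d2, c0, c1, c2, hu, hv⟩ := exists_matrix_of_cycles
    (d0 := (1 + y) / 3) (d1 := (1 + omega ^ 2 * y) / 3) (d2 := (1 + omega * y) / 3)
    (c0 := (-2 - y + (y ^ 2 - 3 * y')) / 9)
    (c1 := (-2 - omega ^ 2 * y + omega * (y ^ 2 - 3 * y')) / 9)
    (c2 := (-2 - omega * y + omega ^ 2 * (y ^ 2 - 3 * y')) / 9)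
    (u := u) (v := v) (by simp only [u, v, f, g]; grind)
  have hM : CycleEquations M y y' := by
    refine ⟨d0, d1, d2, c0, c1, c2, ?_⟩
    change cyclePos M + cycleNeg M = _
    rw [hu, hv]
    simp only [u, v, f, g]
    grind
  let B : SL3 := ⟨M, hM.det_eq_one⟩
  have hB : CycleEquations B.1 y y' := hM
  obtain ⟨ht, ht'⟩ := hB.tr_eq
  have hT : IsTrianglePair diagOmega B := by
    rw [isTrianglePair_diagOmega_iff, ht, ht']
    exact hB
  have hu' : cyclePos B.1 = u := hu
  have hv' : cycleNeg B.1 = v := hv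
  refine ⟨B, hT, ht, ht', ?_, ?_⟩
  · rw [tr_diagOmega_rep_a hT, ht, hu', hv']
    simp only [u, v, f, g]
    clear * - h1 hw
    grind
  · rw [tr_diagOmega_rep_a_inv hT, ht, hu', hv']
    simp only [u, v, f, g]
    clear * - h1 hw
    grind

/-! ### Matrix entries of words as sums over paths. -/

/-- Given a matrix `b` over a commutative algebra and a subalgebra that contains its cycles, the
span of the products of the entries of `b` along the simple paths from `i` to `j`. -/
def pathSpan {k R : Type*} [CommRing k] [CommRing R] [Algebra k R] (S : Subalgebra k R)
    (b : Matrix (Fin 3) (Fin 3) R) (i j : Fin 3) : Submodule S R :=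
  if i = j then Submodule.span S {1}
  else Submodule.span S {b i j, b i (-(i + j)) * b (-(i + j)) j}

/-- The three indices add up to 0 modulo 3, so -(i + j) is the third index. -/
theorem third_ne : ∀ i j : Fin 3, i ≠ j → i ≠ -(i + j) ∧ j ≠ -(i + j) := by decide

theorem third_eq : ∀ i j k : Fin 3, i ≠ j → j ≠ k → i ≠ k → -(i + j) = k := by decide

section pathSpan

variable {k R : Type*} [CommRing k] [CommRing R] [Algebra k R] {S : Subalgebra k R}
  {b : Matrix (Fin 3) (Fin 3) R}

theorem mem_pathSpan_self {i : Fin 3} {x : R} : x ∈ pathSpan S b i i ↔ x ∈ S := by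
  rw [pathSpan, if_pos rfl, Submodule.mem_span_singleton]
  constructor
  · rintro ⟨a, rfl⟩
    rw [Algebra.smul_def, mul_one]
    exact a.2
  · intro hx
    exact ⟨⟨x, hx⟩, by rw [Algebra.smul_def, mul_one]; rfl⟩

theorem mem_pathSpan {i j : Fin 3} (hij : i ≠ j) {x : R} : x ∈ pathSpan S b i j ↔
    ∃ p ∈ S, ∃ q ∈ S, p * b i j + q * (b i (-(i + j)) * b (-(i + j)) j) = x := by
  rw [pathSpan, if_neg hij, Submodule.mem_span_pair]
  constructor
  · rintro ⟨p, q, rfl⟩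
    exact ⟨p, p.2, q, q.2, rfl⟩
  · rintro ⟨p, hp, q, hq, rfl⟩
    exact ⟨⟨p, hp⟩, ⟨q, hq⟩, rfl⟩

theorem entry_mem_pathSpan (h1 : ∀ i, b i i ∈ S) (i j : Fin 3) : b i j ∈ pathSpan S b i j := by
  by_cases hij : i = j
  · subst hij
    exact mem_pathSpan_self.2 (h1 i)
  · exact (mem_pathSpan hij).2 ⟨1, one_mem _, 0, zero_mem _, by ring⟩

/-- A concatenation of two simple paths splits into a simple path and closed cycles, and the cycles
are scalars from `S`. -/
theorem mul_mem_pathSpan (h2 : ∀ i j, i ≠ j → b i j * b j i ∈ S)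
    (h3 : ∀ i j k, i ≠ j → j ≠ k → i ≠ k → b i j * b j k * b k i ∈ S) {i j k : Fin 3} {x y : R}
    (hx : x ∈ pathSpan S b i j) (hy : y ∈ pathSpan S b j k) : x * y ∈ pathSpan S b i k := by
  by_cases hij : i = j
  · subst hij
    exact (pathSpan S b i k).smul_mem ⟨x, mem_pathSpan_self.1 hx⟩ hy
  by_cases hjk : j = k
  · subst hjk
    rw [mul_comm]
    exact (pathSpan S b i j).smul_mem ⟨y, mem_pathSpan_self.1 hy⟩ hx
  obtain ⟨p, hp, q, hq, rfl⟩ := (mem_pathSpan hij).1 hx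
  obtain ⟨p', hp', q', hq', rfl⟩ := (mem_pathSpan hjk).1 hy
  by_cases hik : i = k
  · subst hik
    obtain ⟨l, hl, hil, hjl⟩ : ∃ l, l = -(i + j) ∧ i ≠ l ∧ j ≠ l :=
      ⟨-(i + j), rfl, third_ne i j hij⟩
    rw [add_comm j i, ← hl, mem_pathSpan_self]
    have e : (p * b i j + q * (b i l * b l j)) * (p' * b j i + q' * (b j l * b l i)) =
        p * p' * (b i j * b j i) + p * q' * (b i j * b j l * b l i)
          + q * p' * (b i l * b l j * b j i) + q * q' * ((b i l * b l i) * (b j l * b l j)) := by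
      ring
    rw [e]
    exact add_mem (add_mem (add_mem (mul_mem (mul_mem hp hp') (h2 _ _ hij))
      (mul_mem (mul_mem hp hq') (h3 _ _ _ hij hjl hil)))
      (mul_mem (mul_mem hq hp') (h3 _ _ _ hil hjl.symm hij)))
      (mul_mem (mul_mem hq hq') (mul_mem (h2 _ _ hil) (h2 _ _ hjl)))
  · have e1 : -(i + j) = k := third_eq i j k hij hjk hik
    have e2 : -(j + k) = i := third_eq j k i hjk (Ne.symm hik) (Ne.symm hij)
    have e3 : -(i + k) = j := third_eq i k j hik (Ne.symm hjk) hij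
    rw [e1, e2]
    refine (mem_pathSpan hik).2 ⟨p * q' * (b i j * b j i) + q * p' * (b k j * b j k)
      + q * q' * (b i k * b k j * b j i),
      add_mem (add_mem (mul_mem (mul_mem hp hq') (h2 _ _ hij))
        (mul_mem (mul_mem hq hp') (h2 _ _ (Ne.symm hjk))))
        (mul_mem (mul_mem hq hq') (h3 _ _ _ hik (Ne.symm hjk) hij)),
      p * p', mul_mem hp hp', ?_⟩
    rw [e3]
    ring

end pathSpan

theorem rep_eq_conj {ρ ρ' : Rep3} (g : SL3) (hb : ρ b = g * ρ' b * g⁻¹)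
    (ht : ρ t = g * ρ' t * g⁻¹) : ∀ γ, ρ γ = g * ρ' γ * g⁻¹ := by
  have : ρ = (MulAut.conj g).toMonoidHom.comp ρ' := hom_ext hb ht
  intro γ
  rw [this]
  rfl

/-! ### The characters of triangle representations and their coordinates. -/

namespace CharVariety

/-- The character of a representation, as a point of the variety of characters. -/
def ofRep (ρ : Rep3) : CharVariety := ⟨ρ.char, ρ, rfl⟩

theorem exists_rep (χ : CharVariety) : ∃ ρ : Rep3, ofRep ρ = χ := by
  obtain ⟨χ, ρ, rfl⟩ := χ
  exact ⟨ρ, rfl⟩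

theorem tr_ofRep (ρ : Rep3) (γ : FigEight) : (ofRep ρ).tr γ = SL3.tr (ρ γ) := rfl

theorem ext_tr {χ χ' : CharVariety} (h : ∀ γ, χ.tr γ = χ'.tr γ) : χ = χ' :=
  Subtype.ext (funext h)

/-- The solutions in `ℂ⁸` of the equations of the component `V₂`. -/
def surface : Set (Fin 8 → ℂ) :=
  {p | p 6 = 1 ∧ p 7 = 1 ∧ p 0 * p 1 = p 4 + p 5 + 2 ∧
    p 0 ^ 3 + p 1 ^ 3 = p 4 * p 5 + 5 * p 4 + 5 * p 5 + 5 ∧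
    p 2 = p 0 ^ 2 - p 1 ∧ p 3 = p 1 ^ 2 - p 0}

/-- The characters whose coordinates satisfy the equations of the component `V₂`. -/
def componentV2 : Set CharVariety := {χ | χ.coords ∈ surface}

theorem mem_componentV2 {χ : CharVariety} : χ ∈ componentV2 ↔
    χ.tr b = 1 ∧ χ.tr b⁻¹ = 1 ∧ χ.tr t * χ.tr t⁻¹ = χ.tr a + χ.tr a⁻¹ + 2 ∧
      χ.tr t ^ 3 + χ.tr t⁻¹ ^ 3 =
        χ.tr a * χ.tr a⁻¹ + 5 * χ.tr a + 5 * χ.tr a⁻¹ + 5 ∧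
      χ.tr (t * a⁻¹ * t * a) = χ.tr t ^ 2 - χ.tr t⁻¹ ∧
      χ.tr (a⁻¹ * t⁻¹ * a * t⁻¹) = χ.tr t⁻¹ ^ 2 - χ.tr t := Iff.rfl

theorem relation_a (ρ : Rep3) : ρ t * ρ a * (ρ t)⁻¹ = ρ a * ρ b := by
  simp only [← map_mul, ← map_inv, t_mul_a]

theorem relation_b (ρ : Rep3) : ρ t * ρ b * (ρ t)⁻¹ = ρ b * ρ a * ρ b := by
  simp only [← map_mul, ← map_inv, t_mul_b]

theorem tr_meridian (χ : CharVariety) (h : χ.tr b = 1) (h' : χ.tr b⁻¹ = 1) :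
    χ.tr (t * a⁻¹ * t * a) = χ.tr t ^ 2 - χ.tr t⁻¹ + χ.tr (t * b⁻¹)⁻¹ ∧
      χ.tr (a⁻¹ * t⁻¹ * a * t⁻¹) = χ.tr t⁻¹ ^ 2 - χ.tr t + χ.tr (t * b⁻¹) := by
  obtain ⟨ρ, rfl⟩ := χ.exists_rep
  simp only [tr_ofRep, map_mul, map_inv] at h h' ⊢
  exact tr_meridian_product (relation_a ρ) h h'

theorem exists_conj_triangleRep {ρ : Rep3} (h : (ofRep ρ).tr b = 1) (h' : (ofRep ρ).tr b⁻¹ = 1)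
    (hk : (ofRep ρ).tr (t * b⁻¹) = 0) (hk' : (ofRep ρ).tr (t * b⁻¹)⁻¹ = 0) :
    ∃ (C : SL3) (hC : IsTrianglePair diagOmega C) (g : SL3), ∀ γ, ρ γ = g * hC.rep γ * g⁻¹ := by
  simp only [tr_ofRep, map_mul, map_inv] at h h' hk hk'
  obtain ⟨g, C, hC, h1, h2⟩ :=
    (isTrianglePair_of_relation (relation_a ρ) h h' hk hk').exists_conj
  rw [mul_inv_eq_iff_eq_mul] at h1
  exact ⟨C, hC, g, rep_eq_conj g (by rw [hC.rep_b, h2]) (by rw [hC.rep_t, h1, h2]; group)⟩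

theorem ofRep_eq_of_conj {ρ ρ' : Rep3} {g : SL3} (h : ∀ γ, ρ γ = g * ρ' γ * g⁻¹) :
    ofRep ρ = ofRep ρ' :=
  ext_tr fun γ => by rw [tr_ofRep, tr_ofRep, h, tr_conj]

theorem exists_triangleRep {χ : CharVariety} (h : χ.tr b = 1) (h' : χ.tr b⁻¹ = 1)
    (hk : χ.tr (t * b⁻¹) = 0) (hk' : χ.tr (t * b⁻¹)⁻¹ = 0) :
    ∃ (C : SL3) (hC : IsTrianglePair diagOmega C), ofRep hC.rep = χ := by
  obtain ⟨ρ, rfl⟩ := χ.exists_rep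
  obtain ⟨C, hC, g, hg⟩ := exists_conj_triangleRep h h' hk hk'
  exact ⟨C, hC, (ofRep_eq_of_conj hg).symm⟩

theorem tr_of_mem_componentV2 {χ : CharVariety} (h : χ ∈ componentV2) :
    χ.tr b = 1 ∧ χ.tr b⁻¹ = 1 ∧ χ.tr (t * b⁻¹) = 0 ∧ χ.tr (t * b⁻¹)⁻¹ = 0 := by
  obtain ⟨h1, h2, -, -, h3, h4⟩ := mem_componentV2.1 h
  obtain ⟨h5, h6⟩ := χ.tr_meridian h1 h2
  exact ⟨h1, h2, by linear_combination h4 - h6, by linear_combination h3 - h5⟩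

theorem exists_triangleRep_of_mem {χ : CharVariety} (h : χ ∈ componentV2) :
    ∃ (C : SL3) (hC : IsTrianglePair diagOmega C), ofRep hC.rep = χ := by
  obtain ⟨h1, h2, h3, h4⟩ := tr_of_mem_componentV2 h
  exact exists_triangleRep h1 h2 h3 h4

theorem coords_triangleRep {C : SL3} (hC : IsTrianglePair diagOmega C) :
    (ofRep hC.rep).coords = ![SL3.tr (diagOmega * C), SL3.tr (diagOmega * C)⁻¹,
      SL3.tr (diagOmega * C) ^ 2 - SL3.tr (diagOmega * C)⁻¹,
      SL3.tr (diagOmega * C)⁻¹ ^ 2 - SL3.tr (diagOmega * C),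
      SL3.tr (C⁻¹ * diagOmega * C * diagOmega⁻¹ * C⁻¹),
      SL3.tr (C⁻¹ * diagOmega * C * diagOmega⁻¹ * C⁻¹)⁻¹, 1, 1] := by
  have hb : (ofRep hC.rep).tr b = 1 := by rw [tr_ofRep, hC.rep_b, hC.tr_right]
  have hb' : (ofRep hC.rep).tr b⁻¹ = 1 := by rw [tr_ofRep, map_inv, hC.rep_b, hC.tr_right_inv]
  obtain ⟨h1, h2⟩ := (ofRep hC.rep).tr_meridian hb hb'
  have hk : hC.rep (t * b⁻¹) = diagOmega := by
    rw [map_mul, map_inv, hC.rep_t, hC.rep_b, mul_inv_cancel_right]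
  have k0 : (ofRep hC.rep).tr (t * b⁻¹) = 0 := by rw [tr_ofRep, hk, hC.tr_left]
  have k1 : (ofRep hC.rep).tr (t * b⁻¹)⁻¹ = 0 := by rw [tr_ofRep, map_inv, hk, hC.tr_left_inv]
  rw [k1, add_zero] at h1
  rw [k0, add_zero] at h2
  rw [coords, h1, h2, hb, hb']
  simp only [tr_ofRep, map_inv, hC.rep_t, hC.rep_a]

theorem triangleRep_mem {C : SL3} (hC : IsTrianglePair diagOmega C) :
    ofRep hC.rep ∈ componentV2 := by
  obtain ⟨h1, h2⟩ := tr_equations_of_diagOmega hC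
  change coords _ ∈ surface
  rw [coords_triangleRep]
  exact ⟨rfl, rfl, h1, h2, rfl, rfl⟩

theorem mem_componentV2_of_tr {χ : CharVariety} (h : χ.tr b = 1) (h' : χ.tr b⁻¹ = 1)
    (hk : χ.tr (t * b⁻¹) = 0) (hk' : χ.tr (t * b⁻¹)⁻¹ = 0) : χ ∈ componentV2 := by
  obtain ⟨C, hC, rfl⟩ := exists_triangleRep h h' hk hk'
  exact triangleRep_mem hC

theorem surjOn_coords : Set.SurjOn coords componentV2 surface := by
  rintro p ⟨h6, h7, h1, h2, h3, h4⟩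
  obtain ⟨C, hC, e0, e1, e4, e5⟩ := exists_isTrianglePair_diagOmega h1 h2
  refine ⟨_, triangleRep_mem hC, ?_⟩
  rw [coords_triangleRep, e0, e1, e4, e5]
  ext i
  fin_cases i <;> simp [h3, h4, h6, h7]

/-- Here η is the trace of t⁻³, that is ȳ³ - 3yȳ + 3, and yȳ = α + ᾱ + 2. -/
theorem eta_eq {χ : CharVariety} (h : χ ∈ componentV2) :
    χ.eta = χ.tr t⁻¹ ^ 3 - 3 * (χ.tr a + χ.tr a⁻¹ + 1) := by
  have h3 := (mem_componentV2.1 h).2.2.1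
  obtain ⟨C, hC, rfl⟩ := exists_triangleRep_of_mem h
  have e : (ofRep hC.rep).eta = SL3.tr ((C⁻¹ * diagOmega⁻¹) ^ 3) := by
    rw [eta, tr_ofRep, ← hC.commutator_eq]
    simp only [map_mul, map_inv, hC.rep_a, hC.rep_b]
  have e2 : (ofRep hC.rep).tr t = SL3.tr (diagOmega * C) := by rw [tr_ofRep, hC.rep_t]
  have e3 : (ofRep hC.rep).tr t⁻¹ = SL3.tr (diagOmega * C)⁻¹ := by
    rw [tr_ofRep, map_inv, hC.rep_t]
  rw [e2, e3] at h3
  have e5 : SL3.tr ((diagOmega * C)⁻¹ * (diagOmega * C)⁻¹) =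
      SL3.tr (diagOmega * C)⁻¹ ^ 2 - 2 * SL3.tr (diagOmega * C) := by
    have := tr_mul_self_mul (diagOmega * C)⁻¹ 1
    have h1 : SL3.tr 1 = 3 := by simp [SL3.tr]
    rw [mul_one, mul_one, mul_one, inv_inv, h1] at this
    rw [this]; ring
  have h1 : SL3.tr 1 = 3 := by simp [SL3.tr]
  rw [e, e3, ← mul_inv_rev, pow_succ, pow_two, tr_mul_self_mul, e5, inv_inv, mul_inv_cancel, h1]
  linear_combination -3 * h3

end CharVariety

/-! ### All traces are polynomials in the eight coordinates. -/

/-- The matrices that, together with `diag(1, ω, ω²)`, form a triangle pair. -/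
abbrev TriangleModel : Type := {C : SL3 // IsTrianglePair diagOmega C}

namespace TriangleModel

open CharVariety

/-- The character given by a model. -/
noncomputable def char (w : TriangleModel) : CharVariety := ofRep w.2.rep

/-- The functions on the space of models that are polynomials in the coordinates. -/
def coordAlgebra : Subalgebra ℂ (TriangleModel → ℂ) :=
  Algebra.adjoin ℂ (Set.range fun (i : Fin 8) (w : TriangleModel) => w.char.coords i)

/-- The universal matrix over the functions on the space of models. -/
def univ : Matrix (Fin 3) (Fin 3) (TriangleModel → ℂ) := Matrix.of fun i j w => w.1.1 i j

theorem mem_coordAlgebra {f : TriangleModel → ℂ} : f ∈ coordAlgebra ↔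
    ∃ p : MvPolynomial (Fin 8) ℂ, ∀ w, f w = MvPolynomial.eval w.char.coords p := by
  have h : ∀ (p : MvPolynomial (Fin 8) ℂ) (w : TriangleModel),
      MvPolynomial.aeval (fun (i : Fin 8) (w : TriangleModel) => w.char.coords i) p w =
        MvPolynomial.eval w.char.coords p := by
    intro p w
    induction p using MvPolynomial.induction_on with
    | C a => simp
    | add p q hp hq => simp [hp, hq]
    | mul_X p i hp => simp [hp]
  rw [coordAlgebra, Algebra.adjoin_range_eq_range_aeval]
  constructor
  · rintro ⟨p, rfl⟩
    exact ⟨p, h p⟩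
  · rintro ⟨p, hp⟩
    exact ⟨p, funext fun w => (h p w).trans (hp w).symm⟩

theorem cycleEquations (w : TriangleModel) :
    CycleEquations w.1.1 (w.char.coords 0) (w.char.coords 1) := by
  have := isTrianglePair_diagOmega_iff.1 w.2
  rw [char, coords_triangleRep]
  exact this

theorem coords_a (w : TriangleModel) :
    w.char.coords 4 = (1 + w.char.coords 0 ^ 3) / 9 + 3 * omega ^ 2 * cyclePos w.1.1
        + 3 * omega * cycleNeg w.1.1 ∧
      w.char.coords 5 = (1 + w.char.coords 0 ^ 3) / 9 + 3 * omega * cyclePos w.1.1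
        + 3 * omega ^ 2 * cycleNeg w.1.1 := by
  rw [char, coords_triangleRep]
  exact ⟨tr_diagOmega_rep_a w.2, tr_diagOmega_rep_a_inv w.2⟩

open MvPolynomial in
theorem cyclePos_mem : (fun w : TriangleModel => cyclePos w.1.1) ∈ coordAlgebra := by
  refine mem_coordAlgebra.2 ⟨C (1 / 9) * (C omega * X 4 + C (omega ^ 2) * X 5
    + C (1 / 9) * (1 + X 0 ^ 3)
    + 3 * (1 + C (2 / 27) * (1 + X 0 ^ 3) - C (1 / 3) * (1 + X 0 * X 1))), fun w => ?_⟩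
  have h := w.cycleEquations.sum
  change cyclePos w.1.1 + cycleNeg w.1.1 = _ at h
  obtain ⟨h4, h5⟩ := w.coords_a
  have hw := omega_sq
  simp only [map_mul, map_add, map_sub, eval_C, eval_X, map_pow, map_one, map_ofNat, h4, h5]
  generalize w.char.coords 0 = y at *
  generalize w.char.coords 1 = y' at *
  clear h4 h5
  grind

open MvPolynomial in
theorem cycleNeg_mem : (fun w : TriangleModel => cycleNeg w.1.1) ∈ coordAlgebra := by
  refine mem_coordAlgebra.2 ⟨C (1 / 9) * (C (omega ^ 2) * X 4 + C omega * X 5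
    + C (1 / 9) * (1 + X 0 ^ 3)
    + 3 * (1 + C (2 / 27) * (1 + X 0 ^ 3) - C (1 / 3) * (1 + X 0 * X 1))), fun w => ?_⟩
  have h := w.cycleEquations.sum
  change cyclePos w.1.1 + cycleNeg w.1.1 = _ at h
  obtain ⟨h4, h5⟩ := w.coords_a
  have hw := omega_sq
  simp only [map_mul, map_add, map_sub, eval_C, eval_X, map_pow, map_one, map_ofNat, h4, h5]
  generalize w.char.coords 0 = y at *
  generalize w.char.coords 1 = y' at *
  clear h4 h5
  grind

open MvPolynomial in
theorem univ_diag_mem (i : Fin 3) : univ i i ∈ coordAlgebra := by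
  fin_cases i
  · refine mem_coordAlgebra.2 ⟨C (1 / 3) * (1 + X 0), fun w => w.cycleEquations.d0.trans ?_⟩
    simp only [map_mul, map_add, eval_C, eval_X, map_one]
    ring
  · refine mem_coordAlgebra.2 ⟨C (1 / 3) * (1 + C (omega ^ 2) * X 0),
      fun w => w.cycleEquations.d1.trans ?_⟩
    simp only [map_mul, map_add, eval_C, eval_X, map_one]
    ring
  · refine mem_coordAlgebra.2 ⟨C (1 / 3) * (1 + C omega * X 0),
      fun w => w.cycleEquations.d2.trans ?_⟩
    simp only [map_mul, map_add, eval_C, eval_X, map_one]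
    ring

open MvPolynomial in
theorem univ_mul_mem (i j : Fin 3) (hij : i ≠ j) : univ i j * univ j i ∈ coordAlgebra := by
  have h0 : univ 1 2 * univ 2 1 ∈ coordAlgebra := by
    refine mem_coordAlgebra.2 ⟨C (1 / 9) * (-2 - X 0 + (X 0 ^ 2 - 3 * X 1)),
      fun w => w.cycleEquations.c0.trans ?_⟩
    simp only [map_mul, map_add, map_sub, map_neg, map_pow, eval_C, eval_X, map_ofNat]
    ring
  have h1 : univ 0 2 * univ 2 0 ∈ coordAlgebra := by
    refine mem_coordAlgebra.2 ⟨C (1 / 9) * (-2 - C (omega ^ 2) * X 0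
      + C omega * (X 0 ^ 2 - 3 * X 1)), fun w => w.cycleEquations.c1.trans ?_⟩
    simp only [map_mul, map_add, map_sub, map_neg, map_pow, eval_C, eval_X, map_ofNat]
    ring
  have h2 : univ 0 1 * univ 1 0 ∈ coordAlgebra := by
    refine mem_coordAlgebra.2 ⟨C (1 / 9) * (-2 - C omega * X 0
      + C (omega ^ 2) * (X 0 ^ 2 - 3 * X 1)), fun w => w.cycleEquations.c2.trans ?_⟩
    simp only [map_mul, map_add, map_sub, map_neg, map_pow, eval_C, eval_X, map_ofNat]
    ring
  fin_cases i <;> fin_cases j <;> first | exact absurd rfl hij | assumption | (rw [mul_comm]; assumption)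

theorem univ_mul_mul_mem (i j k : Fin 3) (hij : i ≠ j) (hjk : j ≠ k) (hik : i ≠ k) :
    univ i j * univ j k * univ k i ∈ coordAlgebra := by
  have h1 : univ 0 1 * univ 1 2 * univ 2 0 ∈ coordAlgebra := cyclePos_mem
  have h2 : univ 0 2 * univ 2 1 * univ 1 0 ∈ coordAlgebra := cycleNeg_mem
  fin_cases i <;> fin_cases j <;> fin_cases k <;>
    first
    | exact absurd rfl hij
    | exact absurd rfl hjk
    | exact absurd rfl hik
    | exact h1
    | exact h2
    | (rw [mul_comm, ← mul_assoc]; first | exact h1 | exact h2)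
    | (rw [mul_assoc, mul_comm]; first | exact h1 | exact h2)

/-- The universal representation over the functions on the space of models. -/
noncomputable def univRep (γ : FigEight) : Matrix (Fin 3) (Fin 3) (TriangleModel → ℂ) :=
  Matrix.of fun i j w => (w.2.rep γ).1 i j

theorem univRep_mul_apply (γ δ : FigEight) (i j : Fin 3) :
    univRep (γ * δ) i j = ∑ k, univRep γ i k * univRep δ k j := by
  ext w
  simp [univRep, Matrix.mul_apply]

/-- The image of Γ is generated by b and the constant diagonal matrix k, and b⁻¹ = b³, so each entry
is a sum over paths in b. For i = j the path span is the coordinate algebra itself, whence the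
traces are polynomials in the coordinates. -/
theorem univRep_mem (γ : FigEight) (i j : Fin 3) :
    univRep γ i j ∈ pathSpan coordAlgebra univ i j := by
  have hmul : ∀ γ δ : FigEight, (∀ i j, univRep γ i j ∈ pathSpan coordAlgebra univ i j) →
      (∀ i j, univRep δ i j ∈ pathSpan coordAlgebra univ i j) →
      ∀ i j, univRep (γ * δ) i j ∈ pathSpan coordAlgebra univ i j := by
    intro γ δ hγ hδ i j
    rw [univRep_mul_apply]
    exact sum_mem fun k _ => mul_mem_pathSpan univ_mul_mem univ_mul_mul_mem (hγ i k) (hδ k j)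
  have hscalar : ∀ γ : FigEight, (∃ v : Fin 3 → ℂ, ∀ w : TriangleModel,
      (w.2.rep γ).1 = Matrix.diagonal v) →
      ∀ i j, univRep γ i j ∈ pathSpan coordAlgebra univ i j := by
    rintro γ ⟨v, hv⟩ i j
    by_cases hij : i = j
    · subst hij
      refine mem_pathSpan_self.2 ?_
      have : univRep γ i i = algebraMap ℂ (TriangleModel → ℂ) (v i) := by
        ext w
        simp [univRep, hv]
      rw [this]
      exact coordAlgebra.algebraMap_mem _
    · have : univRep γ i j = 0 := by
        ext w
        simp [univRep, hv, hij]
      rw [this]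
      exact zero_mem _
  have hb : ∀ i j, univRep b i j ∈ pathSpan coordAlgebra univ i j := by
    intro i j
    have : univRep b i j = univ i j := by
      ext w
      simp [univRep, univ]
    rw [this]
    exact entry_mem_pathSpan univ_diag_mem i j
  have hk : ∀ w : TriangleModel, w.2.rep (t * b⁻¹) = diagOmega := by
    intro w
    rw [map_mul, map_inv, w.2.rep_t, w.2.rep_b, mul_inv_cancel_right]
  have hk1 : ∀ i j, univRep (t * b⁻¹) i j ∈ pathSpan coordAlgebra univ i j :=
    hscalar _ ⟨_, fun w => by rw [hk, diagOmega_coe]⟩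
  have hk2 : ∀ i j, univRep (t * b⁻¹)⁻¹ i j ∈ pathSpan coordAlgebra univ i j :=
    hscalar _ ⟨_, fun w => by rw [map_inv, hk, diagOmega_inv_coe]⟩
  have hb' : ∀ i j, univRep b⁻¹ i j ∈ pathSpan coordAlgebra univ i j := by
    have : univRep b⁻¹ = univRep (b * b * b) := by
      ext i j w
      have h1 : w.2.rep b⁻¹ = w.2.rep (b * b * b) := by
        rw [map_inv, inv_eq_iff_mul_eq_one, map_mul, map_mul, w.2.rep_b, ← w.2.right_pow]
        simp only [pow_succ, pow_zero, one_mul, mul_assoc]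
      simp only [univRep, Matrix.of_apply, h1]
    rw [this]
    exact hmul _ _ (hmul _ _ hb hb) hb
  have hγ : γ ∈ Subgroup.closure {b, t} := by rw [closure_eq_top]; trivial
  revert i j
  induction hγ using Subgroup.closure_induction'' with
  | mem x hx =>
    rcases hx with rfl | rfl
    · exact hb
    · have := hmul _ _ hk1 hb
      rwa [inv_mul_cancel_right] at this
  | inv_mem x hx =>
    rcases hx with rfl | rfl
    · exact hb'
    · have := hmul _ _ hb' hk2
      rwa [show b⁻¹ * (t * b⁻¹)⁻¹ = t⁻¹ by group] at this
  | one => exact hscalar _ ⟨fun _ => 1, fun w => by simp⟩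
  | mul x y _ _ hx hy => exact hmul _ _ hx hy

end TriangleModel

namespace CharVariety

/-- On the component `V₂` all traces are polynomials in the coordinates. -/
theorem exists_trace_polynomial (γ : FigEight) : ∃ p : MvPolynomial (Fin 8) ℂ,
    ∀ χ ∈ componentV2, χ.tr γ = MvPolynomial.eval χ.coords p := by
  have h : ∑ i, TriangleModel.univRep γ i i ∈ TriangleModel.coordAlgebra :=
    sum_mem fun i _ => mem_pathSpan_self.1 (TriangleModel.univRep_mem γ i i)
  obtain ⟨p, hp⟩ := TriangleModel.mem_coordAlgebra.1 h
  refine ⟨p, fun χ hχ => ?_⟩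
  obtain ⟨C, hC, rfl⟩ := exists_triangleRep_of_mem hχ
  refine Eq.trans ?_ (hp ⟨C, hC⟩)
  rw [Finset.sum_apply]
  rfl

theorem injOn_coords : Set.InjOn coords componentV2 := by
  intro χ hχ χ' hχ' h
  refine ext_tr fun γ => ?_
  obtain ⟨p, hp⟩ := exists_trace_polynomial γ
  rw [hp χ hχ, hp χ' hχ', h]

theorem bijOn_coords : Set.BijOn coords componentV2 surface :=
  ⟨fun _ h => h, injOn_coords, surjOn_coords⟩

end CharVariety

/-! ### Invariant subspaces, and the irreducible characters over the plane β = β̄ = 1. -/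

theorem SL3.inv_mulVec_mem {M : SL3} {U : Submodule ℂ (Fin 3 → ℂ)}
    (h : ∀ v ∈ U, M.1.mulVec v ∈ U) : ∀ v ∈ U, (M⁻¹).1.mulVec v ∈ U := by
  intro v hv
  have e : (M⁻¹).1 = M.1 * M.1 - SL3.tr M • M.1 + SL3.tr M⁻¹ • 1 := by
    rw [mul_self_eq]; abel
  rw [e, Matrix.add_mulVec, Matrix.sub_mulVec, Matrix.smul_mulVec, Matrix.smul_mulVec,
    Matrix.one_mulVec, ← Matrix.mulVec_mulVec]
  exact U.add_mem (U.sub_mem (h _ (h _ hv)) (U.smul_mem _ (h _ hv))) (U.smul_mem _ hv)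

theorem Rep3.mulVec_mem (ρ : Rep3) {U : Submodule ℂ (Fin 3 → ℂ)}
    (hb : ∀ v ∈ U, (ρ b).1.mulVec v ∈ U) (ht : ∀ v ∈ U, (ρ t).1.mulVec v ∈ U) (γ : FigEight) :
    ∀ v ∈ U, (ρ γ).1.mulVec v ∈ U := by
  have hγ : γ ∈ Subgroup.closure {b, t} := by rw [closure_eq_top]; trivial
  induction hγ using Subgroup.closure_induction with
  | mem x hx =>
    rcases hx with rfl | rfl
    · exact hb
    · exact ht
  | one => simp
  | mul x y _ _ hx hy =>
    intro v hv
    rw [map_mul, Matrix.SpecialLinearGroup.coe_mul, ← Matrix.mulVec_mulVec]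
    exact hx _ (hy _ hv)
  | inv x _ hx =>
    rw [map_inv]
    exact SL3.inv_mulVec_mem hx

theorem Rep3.IsIrred.eq_bot_or_eq_top {ρ : Rep3} (h : ρ.IsIrred) {U : Submodule ℂ (Fin 3 → ℂ)}
    (hb : ∀ v ∈ U, (ρ b).1.mulVec v ∈ U) (ht : ∀ v ∈ U, (ρ t).1.mulVec v ∈ U) :
    U = ⊥ ∨ U = ⊤ := by
  let W : Subrepresentation ρ.toLinear := ⟨U, fun γ v hv => ρ.mulVec_mem hb ht γ v hv⟩
  rcases IsSimpleOrder.eq_bot_or_eq_top (self := h) W with h | h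
  · exact Or.inl (congrArg Subrepresentation.toSubmodule h)
  · exact Or.inr (congrArg Subrepresentation.toSubmodule h)

theorem Rep3.not_isIrred_iff {ρ : Rep3} : ¬ ρ.IsIrred ↔ ∃ U : Submodule ℂ (Fin 3 → ℂ),
    U ≠ ⊥ ∧ U ≠ ⊤ ∧ (∀ v ∈ U, (ρ b).1.mulVec v ∈ U) ∧ ∀ v ∈ U, (ρ t).1.mulVec v ∈ U := by
  constructor
  · intro h
    by_contra! hc
    refine h ?_
    have : Nontrivial (Subrepresentation ρ.toLinear) :=
      ⟨⊥, ⊤, fun e => bot_ne_top (α := Submodule ℂ (Fin 3 → ℂ))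
        (congrArg Subrepresentation.toSubmodule e)⟩
    refine { eq_bot_or_eq_top := fun W => ?_ }
    by_cases h0 : W.toSubmodule = ⊥
    · exact Or.inl (Subrepresentation.toSubmodule_injective h0)
    · by_cases h1 : W.toSubmodule = ⊤
      · exact Or.inr (Subrepresentation.toSubmodule_injective h1)
      · obtain ⟨v, hv, hv'⟩ := hc W.toSubmodule h0 h1 (fun v hv => W.apply_mem_toSubmodule b hv)
        exact absurd (W.apply_mem_toSubmodule t hv) hv'
  · rintro ⟨U, h0, h1, hb, ht⟩ h
    rcases h.eq_bot_or_eq_top hb ht with h | h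
    · exact h0 h
    · exact h1 h

/-- Schur's lemma. -/
theorem Rep3.IsIrred.eq_smul_one {ρ : Rep3} (h : ρ.IsIrred) {N : Matrix (Fin 3) (Fin 3) ℂ}
    (hb : N * (ρ b).1 = (ρ b).1 * N) (ht : N * (ρ t).1 = (ρ t).1 * N) : ∃ z : ℂ, N = z • 1 := by
  obtain ⟨z, hz⟩ := Module.End.exists_eigenvalue (Matrix.toLin' N)
  refine ⟨z, ?_⟩
  have hU : ∀ M : Matrix (Fin 3) (Fin 3) ℂ, N * M = M * N →
      ∀ v ∈ Module.End.eigenspace (Matrix.toLin' N) z,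
        M.mulVec v ∈ Module.End.eigenspace (Matrix.toLin' N) z := by
    intro M hM v hv
    rw [Module.End.mem_eigenspace_iff, Matrix.toLin'_apply] at hv ⊢
    rw [Matrix.mulVec_mulVec, hM, ← Matrix.mulVec_mulVec, hv, Matrix.mulVec_smul]
  rcases h.eq_bot_or_eq_top (hU _ hb) (hU _ ht) with h0 | h1
  · exact absurd h0 hz
  · apply Matrix.toLin'.injective
    refine LinearMap.ext fun v => ?_
    have hv : v ∈ Module.End.eigenspace (Matrix.toLin' N) z := by rw [h1]; trivial
    rw [Module.End.mem_eigenspace_iff] at hv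
    rw [hv]
    simp

/-- Subtracting P³ = z from the Cayley-Hamilton equation leaves a polynomial of degree at most 2
that annihilates P. Unless both traces vanish, P is therefore scalar or satisfies (P - l)(P - m) =
0, and then rank and nullity of P - m give a large eigenspace. -/
theorem SL3.trace_eq_zero_or_exists_eigenspace {P : SL3} {z : ℂ} (h : (P ^ 3).1 = z • 1) :
    (tr P = 0 ∧ tr P⁻¹ = 0) ∨
      ∃ l : ℂ, 2 ≤ Module.finrank ℂ (Module.End.eigenspace (Matrix.toLin' P.1) l) := by
  have h1 : P.1 * (P⁻¹).1 = 1 := by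
    rw [← Matrix.SpecialLinearGroup.coe_mul, mul_inv_cancel, Matrix.SpecialLinearGroup.coe_one]
  have h3 : P.1 * (P.1 * P.1) = z • 1 := by
    rw [← h]
    simp only [pow_succ, pow_zero, one_mul, Matrix.SpecialLinearGroup.coe_mul, mul_assoc]
  set s := tr P
  set s' := tr P⁻¹
  have h2 : P.1 * P.1 = s • P.1 - s' • 1 + (P⁻¹).1 := mul_self_eq P
  have h4 : s • (P.1 * P.1) - s' • P.1 + (1 - z) • (1 : Matrix (Fin 3) (Fin 3) ℂ) = 0 := by
    have := h3
    nth_rw 1 [h2] at this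
    rw [mul_add, mul_sub, mul_smul_comm, mul_smul_comm, mul_one, h1] at this
    rw [sub_smul, one_smul, ← this]
    abel
  by_cases hs : s = 0
  · by_cases hs' : s' = 0
    · exact Or.inl ⟨hs, hs'⟩
    · right
      refine ⟨s'⁻¹ * (1 - z), ?_⟩
      have e : P.1 = (s'⁻¹ * (1 - z)) • 1 := by
        rw [hs, zero_smul, zero_sub, neg_add_eq_zero] at h4
        rw [mul_smul, ← h4, smul_smul, inv_mul_cancel₀ hs', one_smul]
      have : Module.End.eigenspace (Matrix.toLin' P.1) (s'⁻¹ * (1 - z)) = ⊤ := by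
        rw [eq_top_iff]
        intro v _
        rw [Module.End.mem_eigenspace_iff, Matrix.toLin'_apply]
        nth_rw 1 [e]
        rw [Matrix.smul_mulVec, Matrix.one_mulVec]
      rw [this, finrank_top, Module.finrank_fin_fun]
      norm_num
  · right
    obtain ⟨d, hd⟩ := IsAlgClosed.exists_eq_mul_self (discrim s (-s') (1 - z))
    obtain ⟨l, hl⟩ := exists_quadratic_eq_zero hs ⟨d, hd⟩
    set m := s' / s - l
    have hm : (P.1 - l • 1) * (P.1 - m • 1) = 0 := by
      have e1 : l * m = (1 - z) / s := by
        simp only [m]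
        field_simp
        linear_combination -hl
      have e2 : l + m = s' / s := by simp only [m]; ring
      have : (P.1 - l • 1) * (P.1 - m • 1) =
          s⁻¹ • (s • (P.1 * P.1) - s' • P.1 + (1 - z) • (1 : Matrix (Fin 3) (Fin 3) ℂ)) := by
        have e3 : (P.1 - l • 1) * (P.1 - m • 1) = P.1 * P.1 - (l + m) • P.1 + (l * m) • 1 := by
          simp only [sub_mul, mul_sub, smul_mul_assoc, mul_smul_comm, one_mul, mul_one, add_smul,
            smul_sub, smul_smul]
          rw [mul_comm m l]
          abel
        rw [e3, e1, e2, smul_add, smul_sub, smul_smul, smul_smul, smul_smul, inv_mul_cancel₀ hs,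
          one_smul, div_eq_inv_mul, div_eq_inv_mul]
      rw [this, h4, smul_zero]
    have hle : LinearMap.range (Matrix.toLin' (P.1 - m • 1)) ≤
        Module.End.eigenspace (Matrix.toLin' P.1) l := by
      rintro _ ⟨v, rfl⟩
      rw [Module.End.mem_eigenspace_iff, ← sub_eq_zero]
      have := congrArg (fun A => A.mulVec v) hm
      simpa [← Matrix.mulVec_mulVec, Matrix.sub_mulVec, Matrix.smul_mulVec] using this
    have hker : LinearMap.ker (Matrix.toLin' (P.1 - m • 1)) = Module.End.eigenspace (Matrix.toLin' P.1) m := by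
      ext v
      rw [Module.End.mem_eigenspace_iff, LinearMap.mem_ker, ← sub_eq_zero (b := m • v)]
      rw [map_sub, LinearMap.sub_apply, Matrix.toLin'_apply, map_smul, Matrix.toLin'_one]
      rfl
    have hr := LinearMap.finrank_range_add_finrank_ker (Matrix.toLin' (P.1 - m • 1))
    rw [hker, Module.finrank_fin_fun] at hr
    have := Submodule.finrank_mono hle
    by_cases h5 : 2 ≤ Module.finrank ℂ (Module.End.eigenspace (Matrix.toLin' P.1) m)
    · exact ⟨m, h5⟩
    · exact ⟨l, by omega⟩

/-- Conjugation by P = b²t permutes b, b⁻¹ab⁻¹, ba⁻¹ cyclically, so P³ commutes with b. Expanding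
(Pb)³ gives the product of these three elements, which is 1, times P³. -/
theorem conj_relations {G : Type*} [Group G] {A B T : G} (h : T * A * T⁻¹ = A * B)
    (h' : T * B * T⁻¹ = B * A * B) (hB : B ^ 4 = 1) :
    (B * B * T) ^ 3 * B = B * (B * B * T) ^ 3 ∧ (B * B * T * B) ^ 3 = (B * B * T) ^ 3 := by
  have e1 : (B * B * T) * B * (B * B * T)⁻¹ = B⁻¹ * A * B⁻¹ := by
    calc _ = B * B * (T * B * T⁻¹) * B⁻¹ * B⁻¹ := by group
      _ = B ^ 4 * (B⁻¹ * A * B⁻¹) := by rw [h']; simp [pow_succ, mul_assoc]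
      _ = _ := by rw [hB, one_mul]
  have e2 : (B * B * T) * (B * A⁻¹) * (B * B * T)⁻¹ = B := by
    calc _ = B * B * (T * B * T⁻¹) * (T * A * T⁻¹)⁻¹ * B⁻¹ * B⁻¹ := by group
      _ = _ := by rw [h, h']; group
  have e3 : (B * B * T) * (B⁻¹ * A * B⁻¹) * (B * B * T)⁻¹ = B * A⁻¹ := by
    calc _ = ((B * B * T) * (B * A⁻¹) * (B * B * T)⁻¹ * ((B * B * T) * B * (B * B * T)⁻¹))⁻¹ := by
          simp [mul_assoc]
      _ = _ := by rw [e1, e2]; group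
  set P := B * B * T
  constructor
  · rw [← mul_inv_eq_iff_eq_mul]
    calc P ^ 3 * B * (P ^ 3)⁻¹ = P * (P * (P * B * P⁻¹) * P⁻¹) * P⁻¹ := by
          simp [pow_succ, mul_assoc]
      _ = B := by rw [e1, e3, e2]
  · calc (P * B) ^ 3 = (P * B * P⁻¹) * (P * (P * B * P⁻¹) * P⁻¹) *
          (P * (P * (P * B * P⁻¹) * P⁻¹) * P⁻¹) * P ^ 3 := by
          rw [pow_succ, pow_two]; group
      _ = P ^ 3 := by rw [e1, e3, e2]; group

theorem sq_mul_mul_eq_conj {G : Type*} [Group G] {B : G} (T : G) (hB : B ^ 4 = 1) :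
    B * B * T * B = B * B * (T * B⁻¹) * (B * B)⁻¹ := by
  calc B * B * T * B = B * B * (T * B⁻¹) * (B * B)⁻¹ * B ^ 4 := by group
    _ = _ := by rw [hB, mul_one]

namespace CharVariety

/-- The irreducible characters over the plane `β = β̄ = 1` are on the component `V₂`. -/
theorem mem_componentV2_of_isIrred {χ : CharVariety} (hχ : χ.IsIrred) (hb : χ.tr b = 1)
    (hb' : χ.tr b⁻¹ = 1) : χ ∈ componentV2 := by
  obtain ⟨ρ, hρ, h⟩ := hχ
  obtain rfl : ofRep ρ = χ := Subtype.ext h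
  have rB : SL3.tr (ρ b) = 1 := hb
  have rB' : SL3.tr (ρ b)⁻¹ = 1 := by rw [← map_inv]; exact hb'
  have h4 := pow_four_eq_one rB rB'
  obtain ⟨r1, r2⟩ := conj_relations (relation_a ρ) (relation_b ρ) h4
  obtain ⟨s1, s2⟩ := tr_inv_mul_inv_of_relation (relation_a ρ)
  have q0 := sq_mul_mul_eq_conj (ρ t) h4
  have q1 : SL3.tr (ρ b * ρ b * ρ t * ρ b) = SL3.tr (ρ t * (ρ b)⁻¹) := by
    rw [q0, tr_conj]
  have q2 : SL3.tr (ρ b * ρ b * ρ t * ρ b)⁻¹ = SL3.tr (ρ t * (ρ b)⁻¹)⁻¹ := by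
    rw [q0]
    exact tr_eq_of_conj (ρ b * ρ b) (by rw [conj_inv])
  -- Both P = b²t and Pb share their traces, and those of their inverses, with k = tb⁻¹; it is
  -- enough that one of them has traces 0.
  have p1 : SL3.tr (ρ b * ρ b * ρ t) = SL3.tr (ρ t * (ρ b)⁻¹) := by
    rw [tr_mul_self_mul, rB, rB', s1, tr_mul_comm (ρ t)]
    ring
  have p2 : SL3.tr (ρ b * ρ b * ρ t)⁻¹ = SL3.tr (ρ t * (ρ b)⁻¹)⁻¹ := by
    rw [tr_eq_of_conj (ρ t)⁻¹ (show (ρ b * ρ b * ρ t)⁻¹ =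
      (ρ t)⁻¹ * ((ρ b)⁻¹ * (ρ b)⁻¹ * (ρ t)⁻¹) * (ρ t)⁻¹⁻¹ by group), tr_mul_self_mul, inv_inv, rB,
      rB', tr_mul_comm (ρ b)⁻¹, s2, mul_inv_rev, inv_inv]
    ring
  have goal : SL3.tr (ρ t * (ρ b)⁻¹) = 0 ∧ SL3.tr (ρ t * (ρ b)⁻¹)⁻¹ = 0 →
      ofRep ρ ∈ componentV2 := by
    rintro ⟨g1, g2⟩
    rw [← map_inv, ← map_mul] at g1 g2
    rw [← map_inv] at g2
    exact mem_componentV2_of_tr hb hb' g1 g2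
  set B := ρ b
  set T := ρ t
  obtain ⟨z, hz⟩ : ∃ z : ℂ, ((B * B * T) ^ 3).1 = z • 1 := by
    refine hρ.eq_smul_one (N := ((B * B * T) ^ 3).1) (congrArg Subtype.val r1) ?_
    refine congrArg Subtype.val (?_ : (B * B * T) ^ 3 * T = T * (B * B * T) ^ 3)
    have r3 : Commute ((B * B * T) ^ 3) B := r1
    have e : T = (B * B)⁻¹ * (B * B * T) := by rw [inv_mul_cancel_left]
    have r4 : Commute ((B * B * T) ^ 3) ((B * B)⁻¹ * (B * B * T)) :=
      (r3.mul_right r3).inv_right.mul_right (Commute.pow_self _ 3)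
    rwa [← e] at r4
  rcases trace_eq_zero_or_exists_eigenspace hz with h0 | ⟨l, hl⟩
  · exact goal (by rwa [p1, p2] at h0)
  rw [← r2] at hz
  rcases trace_eq_zero_or_exists_eigenspace hz with h0 | ⟨m, hm⟩
  · exact goal (by rwa [q1, q2] at h0)
  exfalso
  -- Two subspaces of dimension at least 2 in ℂ³ meet. A common eigenvector of P and Pb is one of b
  -- = P⁻¹(Pb) and of t = b⁻²P.
  obtain ⟨v, hv0, hvl, hvm⟩ : ∃ v : Fin 3 → ℂ, v ≠ 0 ∧
      v ∈ Module.End.eigenspace (Matrix.toLin' (B * B * T).1) l ∧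
      v ∈ Module.End.eigenspace (Matrix.toLin' (B * B * T * B).1) m := by
    have hd := Submodule.finrank_sup_add_finrank_inf_eq
      (Module.End.eigenspace (Matrix.toLin' (B * B * T).1) l) (Module.End.eigenspace (Matrix.toLin' (B * B * T * B).1) m)
    have hle := Submodule.finrank_le (Module.End.eigenspace (Matrix.toLin' (B * B * T).1) l ⊔
      Module.End.eigenspace (Matrix.toLin' (B * B * T * B).1) m)
    rw [Module.finrank_fin_fun] at hle
    have hne : Module.End.eigenspace (Matrix.toLin' (B * B * T).1) l ⊓
        Module.End.eigenspace (Matrix.toLin' (B * B * T * B).1) m ≠ ⊥ := by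
      intro h0
      rw [h0, finrank_bot] at hd
      omega
    obtain ⟨v, hv, hv0⟩ := Submodule.exists_mem_ne_zero_of_ne_bot hne
    exact ⟨v, hv0, hv.1, hv.2⟩
  have hline : ∀ M : SL3, (∃ c : ℂ, M.1.mulVec v = c • v) →
      ∀ u ∈ ℂ ∙ v, M.1.mulVec u ∈ ℂ ∙ v := by
    rintro M ⟨c, hc⟩ u hu
    obtain ⟨d, rfl⟩ := Submodule.mem_span_singleton.1 hu
    rw [Matrix.mulVec_smul, hc]
    exact Submodule.smul_mem _ _ (Submodule.smul_mem _ _ (Submodule.mem_span_singleton_self v))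
  have hP := hline (B * B * T) ⟨l, by rwa [Module.End.mem_eigenspace_iff, Matrix.toLin'_apply] at hvl⟩
  have hQ := hline (B * B * T * B) ⟨m, by rwa [Module.End.mem_eigenspace_iff, Matrix.toLin'_apply] at hvm⟩
  have hmul : ∀ M N : SL3, (∀ u ∈ ℂ ∙ v, M.1.mulVec u ∈ ℂ ∙ v) →
      (∀ u ∈ ℂ ∙ v, N.1.mulVec u ∈ ℂ ∙ v) → ∀ u ∈ ℂ ∙ v, (M * N).1.mulVec u ∈ ℂ ∙ v := by
    intro M N hM hN u hu
    rw [Matrix.SpecialLinearGroup.coe_mul, ← Matrix.mulVec_mulVec]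
    exact hM _ (hN _ hu)
  have hBv := hmul _ _ (SL3.inv_mulVec_mem hP) hQ
  rw [inv_mul_cancel_left] at hBv
  have hTv := hmul _ _ (SL3.inv_mulVec_mem (hmul _ _ hBv hBv)) hP
  rw [inv_mul_cancel_left] at hTv
  have hfin := finrank_span_singleton (K := ℂ) hv0
  rcases hρ.eq_bot_or_eq_top hBv hTv with h | h
  · rw [h, finrank_bot] at hfin
    omega
  · rw [h, finrank_top, Module.finrank_fin_fun] at hfin
    omega

end CharVariety

/-! ### The ideal of the surface is prime and is its vanishing ideal. -/

namespace CharVariety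

open MvPolynomial

/-- The polynomials that define the component `V₂`. -/
noncomputable def surfaceIdeal : Ideal (MvPolynomial (Fin 8) ℂ) :=
  Ideal.span {X 6 - 1, X 7 - 1, X 0 * X 1 - (X 4 + X 5 + 2),
    X 0 ^ 3 + X 1 ^ 3 - (X 4 * X 5 + 5 * X 4 + 5 * X 5 + 5),
    X 2 - (X 0 ^ 2 - X 1), X 3 - (X 1 ^ 2 - X 0)}

theorem eval_eq_zero_of_mem_surfaceIdeal {f : MvPolynomial (Fin 8) ℂ} (hf : f ∈ surfaceIdeal)
    {p : Fin 8 → ℂ} (hp : p ∈ surface) : eval p f = 0 := by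
  obtain ⟨h6, h7, h1, h2, h3, h4⟩ := hp
  have : surfaceIdeal ≤ RingHom.ker (eval p) := by
    refine Ideal.span_le.2 ?_
    rintro _ (rfl | rfl | rfl | rfl | rfl | rfl) <;>
      simp [RingHom.mem_ker, h6, h7, h1, h2, h3, h4]
  exact this hf

/-- The inclusion of the polynomials in the first two coordinates. -/
noncomputable def incl : MvPolynomial (Fin 2) ℂ →ₐ[ℂ] MvPolynomial (Fin 8) ℂ := rename ![0, 1]

theorem eval_incl (A : MvPolynomial (Fin 2) ℂ) (p : Fin 8 → ℂ) :
    eval p (incl A) = eval ![p 0, p 1] A := by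
  rw [incl, eval_rename]
  congr 2
  ext i
  fin_cases i <;> rfl

/-- The sum of the two values of `α` over a point `(y, ȳ)`. -/
noncomputable def rootSum : MvPolynomial (Fin 2) ℂ := X 0 * X 1 - 2

/-- Minus the product of the two values of `α` over a point `(y, ȳ)`. -/
noncomputable def rootProd : MvPolynomial (Fin 2) ℂ := 5 * rootSum + 5 - X 0 ^ 3 - X 1 ^ 3

/-- The discriminant of the double cover `(y, ȳ, α) ↦ (y, ȳ)`. -/
noncomputable def rootDiscr : MvPolynomial (Fin 2) ℂ := rootSum ^ 2 + 4 * rootProd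

/-- Modulo the ideal every polynomial is linear in `α` over the polynomials in `y`, `ȳ`. -/
theorem exists_linear (f : MvPolynomial (Fin 8) ℂ) : ∃ A B : MvPolynomial (Fin 2) ℂ,
    f - (incl A + incl B * X 4) ∈ surfaceIdeal := by
  let q := Ideal.Quotient.mk surfaceIdeal
  suffices h : ∃ A B, q f = q (incl A) + q (incl B) * q (X 4) by
    obtain ⟨A, B, h⟩ := h
    exact ⟨A, B, Ideal.Quotient.eq.1 (by simpa [q] using h)⟩
  have hq : ∀ g ∈ surfaceIdeal, q g = 0 := fun g hg => Ideal.Quotient.eq_zero_iff_mem.2 hg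
  have h6 := hq (X 6 - 1) (Ideal.subset_span (by simp))
  have h7 := hq (X 7 - 1) (Ideal.subset_span (by simp))
  have h1 := hq (X 0 * X 1 - (X 4 + X 5 + 2)) (Ideal.subset_span (by simp))
  have h2 := hq (X 0 ^ 3 + X 1 ^ 3 - (X 4 * X 5 + 5 * X 4 + 5 * X 5 + 5))
    (Ideal.subset_span (by simp))
  have h3 := hq (X 2 - (X 0 ^ 2 - X 1)) (Ideal.subset_span (by simp))
  have h4 := hq (X 3 - (X 1 ^ 2 - X 0)) (Ideal.subset_span (by simp))
  simp only [map_sub, map_add, map_mul, map_pow, map_one, map_ofNat] at h6 h7 h1 h2 h3 h4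
  have i0 : incl (X 0) = X 0 := by simp [incl]
  have i1 : incl (X 1) = X 1 := by simp [incl]
  have hs : q (incl rootSum) = q (X 0) * q (X 1) - 2 := by
    simp only [rootSum, map_sub, map_mul, map_ofNat, i0, i1]
  have hp : q (incl rootProd) = 5 * (q (X 0) * q (X 1) - 2) + 5 - q (X 0) ^ 3 - q (X 1) ^ 3 := by
    simp only [rootProd, map_sub, map_add, map_mul, map_pow, map_ofNat, i0, i1, hs]
  have hsq : q (X 4) * q (X 4) = q (incl rootSum) * q (X 4) + q (incl rootProd) := by
    rw [hs, hp]
    linear_combination (q (X 4) + 5) * (-h1) + h2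
  have hX : ∀ i : Fin 8, ∃ A B, q (X i) = q (incl A) + q (incl B) * q (X 4) := by
    intro i
    match i with
    | 0 => exact ⟨X 0, 0, by simp [i0]⟩
    | 1 => exact ⟨X 1, 0, by simp [i1]⟩
    | 2 =>
      refine ⟨X 0 ^ 2 - X 1, 0, ?_⟩
      simp only [map_sub, map_pow, i0, i1, map_zero, zero_mul, add_zero]
      linear_combination h3
    | 3 =>
      refine ⟨X 1 ^ 2 - X 0, 0, ?_⟩
      simp only [map_sub, map_pow, i0, i1, map_zero, zero_mul, add_zero]
      linear_combination h4
    | 4 => exact ⟨0, 1, by simp⟩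
    | 5 =>
      refine ⟨rootSum, -1, ?_⟩
      simp only [hs, map_neg, map_one]
      linear_combination -h1
    | 6 =>
      refine ⟨1, 0, ?_⟩
      simp only [map_one, map_zero, zero_mul, add_zero]
      linear_combination h6
    | 7 =>
      refine ⟨1, 0, ?_⟩
      simp only [map_one, map_zero, zero_mul, add_zero]
      linear_combination h7
  induction f using MvPolynomial.induction_on with
  | C a => exact ⟨C a, 0, by simp [incl]⟩
  | add f g hf hg =>
    obtain ⟨A, B, hf⟩ := hf
    obtain ⟨A', B', hg⟩ := hg
    refine ⟨A + A', B + B', ?_⟩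
    simp only [map_add, hf, hg]
    ring
  | mul_X f i hf =>
    obtain ⟨A, B, hf⟩ := hf
    obtain ⟨A', B', hg⟩ := hX i
    refine ⟨A * A' + B * B' * rootProd, A * B' + B * A' + B * B' * rootSum, ?_⟩
    simp only [map_add, map_mul, hf, hg]
    linear_combination q (incl B) * q (incl B') * hsq

/-- The point of the surface with given `y`, `ȳ` and `α`. -/
noncomputable def surfacePoint (y y' α : ℂ) : Fin 8 → ℂ :=
  ![y, y', y ^ 2 - y', y' ^ 2 - y, α, y * y' - 2 - α, 1, 1]

theorem surfacePoint_mem {y y' α : ℂ}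
    (h : α ^ 2 = eval ![y, y'] rootSum * α + eval ![y, y'] rootProd) :
    surfacePoint y y' α ∈ surface := by
  simp only [rootProd, rootSum, map_sub, map_add, map_mul, map_pow, map_ofNat, eval_X,
    Matrix.cons_val] at h
  refine ⟨rfl, rfl, ?_, ?_, rfl, rfl⟩
  · simp only [surfacePoint, Matrix.cons_val]
    ring
  · simp only [surfacePoint, Matrix.cons_val]
    linear_combination h

theorem eval_surfacePoint {f : MvPolynomial (Fin 8) ℂ} {A B : MvPolynomial (Fin 2) ℂ}
    (h : f - (incl A + incl B * X 4) ∈ surfaceIdeal) {y y' α : ℂ}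
    (hα : α ^ 2 = eval ![y, y'] rootSum * α + eval ![y, y'] rootProd) :
    eval (surfacePoint y y' α) f = eval ![y, y'] A + eval ![y, y'] B * α := by
  have := eval_eq_zero_of_mem_surfaceIdeal h (surfacePoint_mem hα)
  rw [map_sub, sub_eq_zero] at this
  rw [this, map_add, map_mul, eval_incl, eval_incl, eval_X]
  rfl

theorem exists_roots (y y' : ℂ) : ∃ α₁ α₂ : ℂ,
    α₁ ^ 2 = eval ![y, y'] rootSum * α₁ + eval ![y, y'] rootProd ∧
    α₂ ^ 2 = eval ![y, y'] rootSum * α₂ + eval ![y, y'] rootProd ∧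
    α₁ + α₂ = eval ![y, y'] rootSum ∧ α₁ * α₂ = - eval ![y, y'] rootProd := by
  obtain ⟨d, hd⟩ := IsAlgClosed.exists_eq_mul_self (eval ![y, y'] rootDiscr)
  simp only [rootDiscr, map_add, map_mul, map_pow, map_ofNat] at hd
  generalize eval ![y, y'] rootSum = s at *
  generalize eval ![y, y'] rootProd = r at *
  exact ⟨(s + d) / 2, (s - d) / 2, by linear_combination -hd / 4, by linear_combination -hd / 4,
    by ring, by linear_combination hd / 4⟩

/-- On the line ȳ = 0 the discriminant is -4y³ - 16, of odd degree. -/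
theorem rootDiscr_ne_sq (F : MvPolynomial (Fin 2) ℂ) : F ^ 2 ≠ rootDiscr := by
  intro h
  have h1 := congrArg (aeval ![(Polynomial.X : Polynomial ℂ), 0]) h
  have h2 : aeval ![(Polynomial.X : Polynomial ℂ), 0] rootDiscr =
      Polynomial.C (-4) * Polynomial.X ^ 3 + Polynomial.C (-16) := by
    simp only [rootDiscr, rootProd, rootSum, map_add, map_sub, map_mul, map_pow, map_ofNat, aeval_X,
      Matrix.cons_val, map_neg]
    ring
  rw [h2, map_pow] at h1
  have h3 := congrArg Polynomial.natDegree h1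
  rw [Polynomial.natDegree_pow, Polynomial.natDegree_add_C,
    Polynomial.natDegree_C_mul_X_pow _ _ (by norm_num)] at h3
  omega

/-- If B were nonzero, integral closedness would give B ∣ 2A + Bs, where s is `rootSum`, and the
quotient would be a square root of the discriminant. -/
theorem eval_eq_zero_of_norm {A B : MvPolynomial (Fin 2) ℂ}
    (h : (2 * A + B * rootSum) ^ 2 = B ^ 2 * rootDiscr) : A = 0 ∧ B = 0 := by
  by_cases hB : B = 0
  · refine ⟨?_, hB⟩
    have h2 : (2 : MvPolynomial (Fin 2) ℂ) ≠ 0 := two_ne_zero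
    simpa [hB, h2] using h
  · exfalso
    have hd : B ^ 2 ∣ (2 * A + B * rootSum) ^ 2 := ⟨_, h⟩
    rw [IsIntegrallyClosed.pow_dvd_pow_iff two_ne_zero] at hd
    obtain ⟨F, hF⟩ := hd
    rw [hF, mul_pow] at h
    exact rootDiscr_ne_sq F (mul_left_cancel₀ (pow_ne_zero 2 hB) h)

/-- The norm of a function on the surface over the plane. -/
theorem eval_norm {f : MvPolynomial (Fin 8) ℂ} {A B : MvPolynomial (Fin 2) ℂ}
    (h : f - (incl A + incl B * X 4) ∈ surfaceIdeal) {y y' α₁ α₂ : ℂ}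
    (h1 : α₁ ^ 2 = eval ![y, y'] rootSum * α₁ + eval ![y, y'] rootProd)
    (h2 : α₂ ^ 2 = eval ![y, y'] rootSum * α₂ + eval ![y, y'] rootProd)
    (h3 : α₁ + α₂ = eval ![y, y'] rootSum) (h4 : α₁ * α₂ = - eval ![y, y'] rootProd) :
    eval ![y, y'] ((2 * A + B * rootSum) ^ 2 - B ^ 2 * rootDiscr) =
      4 * (eval (surfacePoint y y' α₁) f * eval (surfacePoint y y' α₂) f) := by
  rw [eval_surfacePoint h h1, eval_surfacePoint h h2]
  simp only [rootDiscr, map_add, map_sub, map_mul, map_pow, map_ofNat]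
  linear_combination -4 * eval ![y, y'] A * eval ![y, y'] B * h3 - 4 * eval ![y, y'] B ^ 2 * h4

/-- The expression is four times the norm of A + Bα over ℂ[y, ȳ]. It reduces membership in the ideal
to a polynomial identity in the plane, which can be tested at points; multiplicativity of the norm
then gives primality. -/
theorem norm_eq_zero_iff {f : MvPolynomial (Fin 8) ℂ} {A B : MvPolynomial (Fin 2) ℂ}
    (h : f - (incl A + incl B * X 4) ∈ surfaceIdeal) :
    (2 * A + B * rootSum) ^ 2 - B ^ 2 * rootDiscr = 0 ↔ f ∈ surfaceIdeal := by
  constructor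
  · intro h0
    obtain ⟨rfl, rfl⟩ := eval_eq_zero_of_norm (sub_eq_zero.1 h0)
    simpa using h
  · intro hf
    refine MvPolynomial.funext fun v => ?_
    obtain ⟨α₁, α₂, h1, h2, h3, h4⟩ := exists_roots (v 0) (v 1)
    have hv : v = ![v 0, v 1] := by ext i; fin_cases i <;> rfl
    rw [hv, eval_norm h h1 h2 h3 h4, eval_eq_zero_of_mem_surfaceIdeal hf (surfacePoint_mem h1)]
    simp

theorem mem_surfaceIdeal_iff {f : MvPolynomial (Fin 8) ℂ} :
    f ∈ surfaceIdeal ↔ ∀ p ∈ surface, eval p f = 0 := by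
  refine ⟨fun hf p hp => eval_eq_zero_of_mem_surfaceIdeal hf hp, fun hf => ?_⟩
  obtain ⟨A, B, h⟩ := exists_linear f
  rw [← norm_eq_zero_iff h]
  refine MvPolynomial.funext fun v => ?_
  obtain ⟨α₁, α₂, h1, h2, h3, h4⟩ := exists_roots (v 0) (v 1)
  have hv : v = ![v 0, v 1] := by ext i; fin_cases i <;> rfl
  rw [hv, eval_norm h h1 h2 h3 h4, hf _ (surfacePoint_mem h1)]
  simp

theorem vanishingIdeal_surface : vanishingIdeal ℂ surface = surfaceIdeal := by
  ext f
  rw [mem_vanishingIdeal_iff, mem_surfaceIdeal_iff]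
  rfl

/-- The surface is irreducible. -/
theorem mem_or_mem_of_mul_mem {f g : MvPolynomial (Fin 8) ℂ} (h : f * g ∈ surfaceIdeal) :
    f ∈ surfaceIdeal ∨ g ∈ surfaceIdeal := by
  obtain ⟨A, B, hf⟩ := exists_linear f
  obtain ⟨A', B', hg⟩ := exists_linear g
  rw [← norm_eq_zero_iff hf, ← norm_eq_zero_iff hg, ← mul_eq_zero]
  refine MvPolynomial.funext fun v => ?_
  obtain ⟨α₁, α₂, h1, h2, h3, h4⟩ := exists_roots (v 0) (v 1)
  have hv : v = ![v 0, v 1] := by ext i; fin_cases i <;> rfl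
  have := eval_eq_zero_of_mem_surfaceIdeal h (surfacePoint_mem h1)
  rw [map_mul] at this
  rw [hv, map_mul, eval_norm hf h1 h2 h3 h4, eval_norm hg h1 h2 h3 h4, map_zero]
  linear_combination 16 * eval (surfacePoint (v 0) (v 1) α₂) f *
    eval (surfacePoint (v 0) (v 1) α₂) g * this

end CharVariety

/-! ### The Zariski topology: irreducibility of the surface and the Noetherian property. -/

namespace CharVariety

open MvPolynomial TopologicalSpace

theorem isClosed_iff {Z : Set CharVariety} : IsClosed Z ↔ ∃ P, zeros P = Z := by
  rw [← isOpen_compl_iff]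
  change Zᶜᶜ ∈ Set.range zeros ↔ _
  rw [compl_compl]
  rfl

theorem isClosed_eval_eq_zero (p : MvPolynomial FigEight ℂ) :
    IsClosed {χ : CharVariety | eval χ.tr p = 0} :=
  isClosed_iff.2 ⟨{p}, by simp [zeros]⟩

theorem isClosed_eval_eq (p q : MvPolynomial FigEight ℂ) :
    IsClosed {χ : CharVariety | eval χ.tr p = eval χ.tr q} := by
  have := isClosed_eval_eq_zero (p - q)
  simpa only [map_sub, sub_eq_zero] using this

theorem isClosed_componentV2 : IsClosed componentV2 := by
  have h : ∀ p q : MvPolynomial FigEight ℂ, IsClosed {χ : CharVariety | eval χ.tr p = eval χ.tr q} :=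
    isClosed_eval_eq
  convert (((((h (X b) 1).inter (h (X b⁻¹) 1)).inter
    (h (X t * X t⁻¹) (X a + X a⁻¹ + 2))).inter
    (h (X t ^ 3 + X t⁻¹ ^ 3) (X a * X a⁻¹ + 5 * X a + 5 * X a⁻¹ + 5))).inter
    (h (X (t * a⁻¹ * t * a)) (X t ^ 2 - X t⁻¹))).inter
    (h (X (a⁻¹ * t⁻¹ * a * t⁻¹)) (X t⁻¹ ^ 2 - X t)) using 1
  ext χ
  simp only [mem_componentV2, Set.mem_inter_iff, Set.mem_ofPred_eq, map_add, map_sub, map_mul,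
    map_pow, map_ofNat, map_one, eval_X, and_assoc]

/-- On the component `V₂` all regular functions are polynomials in the coordinates. -/
theorem exists_coord_polynomial (P : MvPolynomial FigEight ℂ) : ∃ p : MvPolynomial (Fin 8) ℂ,
    ∀ χ ∈ componentV2, eval χ.tr P = eval χ.coords p := by
  choose q hq using exists_trace_polynomial
  refine ⟨aeval q P, fun χ hχ => ?_⟩
  induction P using MvPolynomial.induction_on with
  | C z => simp
  | add P Q hP hQ => simp [hP, hQ]
  | mul_X P γ hP => simp [hP, hq γ χ hχ]

theorem mem_surfaceIdeal_iff_coords {f : MvPolynomial (Fin 8) ℂ} :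
    f ∈ surfaceIdeal ↔ ∀ χ ∈ componentV2, eval χ.coords f = 0 := by
  rw [mem_surfaceIdeal_iff, ← bijOn_coords.image_eq]
  exact Set.forall_mem_image

theorem componentV2_nonempty : componentV2.Nonempty := by
  obtain ⟨α₁, -, h, -⟩ := exists_roots 0 0
  obtain ⟨χ, hχ, -⟩ := surjOn_coords (surfacePoint_mem h)
  exact ⟨χ, hχ⟩

theorem isIrreducible_componentV2 : IsIrreducible componentV2 := by
  refine ⟨componentV2_nonempty, isPreirreducible_iff_isClosed_union_isClosed.2 ?_⟩
  intro Z₁ Z₂ h₁ h₂ h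
  by_contra! hc
  obtain ⟨⟨χ₁, m₁, n₁⟩, ⟨χ₂, m₂, n₂⟩⟩ := And.imp Set.not_subset.1 Set.not_subset.1 hc
  obtain ⟨P₁, rfl⟩ := isClosed_iff.1 h₁
  obtain ⟨P₂, rfl⟩ := isClosed_iff.1 h₂
  simp only [zeros, Set.mem_ofPred_eq, not_forall] at n₁ n₂
  obtain ⟨p₁, hp₁, n₁⟩ := n₁
  obtain ⟨p₂, hp₂, n₂⟩ := n₂
  obtain ⟨q₁, hq₁⟩ := exists_coord_polynomial p₁
  obtain ⟨q₂, hq₂⟩ := exists_coord_polynomial p₂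
  have : q₁ * q₂ ∈ surfaceIdeal := by
    rw [mem_surfaceIdeal_iff_coords]
    intro χ hχ
    rw [map_mul, ← hq₁ χ hχ, ← hq₂ χ hχ]
    rcases h hχ with h | h
    · rw [h p₁ hp₁, zero_mul]
    · rw [h p₂ hp₂, mul_zero]
  rcases mem_or_mem_of_mul_mem this with h | h
  · exact n₁ (by rw [hq₁ _ m₁, mem_surfaceIdeal_iff_coords.1 h _ m₁])
  · exact n₂ (by rw [hq₂ _ m₂, mem_surfaceIdeal_iff_coords.1 h _ m₂])

/-- The entries of the matrices of the generators `b` and `t`. -/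
def genEntries (ρ : Rep3) : Bool × Fin 3 × Fin 3 → ℂ :=
  fun x => (ρ (if x.1 then b else t)).1 x.2.1 x.2.2

theorem exists_entry_polynomial (γ : FigEight) :
    ∃ M : Matrix (Fin 3) (Fin 3) (MvPolynomial (Bool × Fin 3 × Fin 3) ℂ),
      ∀ ρ : Rep3, (ρ γ).1 = (eval (genEntries ρ)).mapMatrix M := by
  have hγ : γ ∈ Subgroup.closure {b, t} := by rw [closure_eq_top]; trivial
  induction hγ using Subgroup.closure_induction with
  | mem x hx =>
    rcases hx with rfl | rfl
    · refine ⟨Matrix.of fun i j => X (true, i, j), fun ρ => ?_⟩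
      ext i j
      simp [genEntries]
    · refine ⟨Matrix.of fun i j => X (false, i, j), fun ρ => ?_⟩
      ext i j
      simp [genEntries]
  | one => exact ⟨1, fun ρ => by simp⟩
  | mul x y _ _ hx hy =>
    obtain ⟨M, hM⟩ := hx
    obtain ⟨N, hN⟩ := hy
    exact ⟨M * N, fun ρ => by rw [map_mul, map_mul, Matrix.SpecialLinearGroup.coe_mul, hM, hN]⟩
  | inv x _ hx =>
    obtain ⟨M, hM⟩ := hx
    exact ⟨M.adjugate, fun ρ => by
      rw [map_inv, Matrix.SpecialLinearGroup.coe_inv, RingHom.map_adjugate, hM]⟩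

/-- Regular functions are polynomials in infinitely many traces; pulled back to representations they
involve only the 18 entries of b and t, so that Hilbert's basis theorem applies. -/
theorem exists_genEntries_polynomial (P : MvPolynomial FigEight ℂ) :
    ∃ p : MvPolynomial (Bool × Fin 3 × Fin 3) ℂ,
      ∀ ρ : Rep3, eval (ofRep ρ).tr P = eval (genEntries ρ) p := by
  choose M hM using exists_entry_polynomial
  refine ⟨aeval (fun γ => (M γ).trace) P, fun ρ => ?_⟩
  have h : ∀ γ, (ofRep ρ).tr γ = eval (genEntries ρ) (M γ).trace := by
    intro γ
    change Matrix.trace (ρ γ).1 = _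
    rw [hM, RingHom.mapMatrix_apply, Matrix.trace, Matrix.trace, map_sum]
    rfl
  induction P using MvPolynomial.induction_on with
  | C z => simp
  | add P Q hP hQ => simp [hP, hQ]
  | mul_X P γ hP => simp [hP, h]

/-- The ideal of the representations with character in `Z`. -/
noncomputable def repIdeal (Z : Set CharVariety) : Ideal (MvPolynomial (Bool × Fin 3 × Fin 3) ℂ) :=
  vanishingIdeal ℂ (genEntries '' {ρ | ofRep ρ ∈ Z})

theorem repIdeal_strictAnti : StrictAnti fun Z : Closeds CharVariety => repIdeal Z := by
  intro Z₁ Z₂ h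
  refine lt_of_le_of_ne (vanishingIdeal_anti_mono (Set.image_mono fun ρ hρ => h.le hρ)) ?_
  intro he
  replace he : repIdeal Z₂ = repIdeal Z₁ := he
  obtain ⟨χ, h2, h1⟩ := Set.exists_of_ssubset h
  obtain ⟨P, hP⟩ := isClosed_iff.1 Z₁.isClosed
  have h1' : χ ∉ zeros P := by rw [hP]; exact h1
  simp only [zeros, Set.mem_ofPred_eq, not_forall] at h1'
  obtain ⟨p, hp, hne⟩ := h1'
  obtain ⟨q, hq⟩ := exists_genEntries_polynomial p
  obtain ⟨ρ, rfl⟩ := χ.exists_rep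
  have hm : q ∈ repIdeal Z₁ := by
    rw [repIdeal, mem_vanishingIdeal_iff]
    rintro _ ⟨ρ', hρ', rfl⟩
    change eval (genEntries ρ') q = 0
    rw [← hq]
    change ofRep ρ' ∈ (Z₁ : Set CharVariety) at hρ'
    rw [← hP] at hρ'
    exact hρ' p hp
  rw [← he, repIdeal, mem_vanishingIdeal_iff] at hm
  have : eval (genEntries ρ) q = 0 := hm _ ⟨ρ, h2, rfl⟩
  rw [← hq] at this
  exact hne this

instance : NoetherianSpace CharVariety :=
  ((noetherianSpace_TFAE CharVariety).out 0 1).2 repIdeal_strictAnti.wellFoundedLT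

end CharVariety

/-! ### The reducible characters on the surface. -/

namespace CharVariety

theorem single_mem_of_diagOmega {U : Submodule ℂ (Fin 3 → ℂ)}
    (hU : ∀ v ∈ U, diagOmega.1.mulVec v ∈ U) {v : Fin 3 → ℂ} (hv : v ∈ U) {i : Fin 3}
    (hi : v i ≠ 0) : Pi.single i 1 ∈ U := by
  have hw := omega_sq
  have e1 : diagOmega.1.mulVec v = ![v 0, omega * v 1, omega ^ 2 * v 2] := by
    ext j
    rw [diagOmega_coe, Matrix.mulVec_diagonal]
    fin_cases j <;> simp
  have e2 : diagOmega.1.mulVec (diagOmega.1.mulVec v) = ![v 0, omega ^ 2 * v 1, omega * v 2] := by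
    ext j
    rw [e1, diagOmega_coe, Matrix.mulVec_diagonal]
    fin_cases j
    · simp
    · simp [pow_two, mul_assoc]
    · simp only [Fin.reduceFinMk, Matrix.cons_val]
      linear_combination omega * v 2 * omega_pow_three
  -- For z = 1, ω, ω² this is three times the projection of v to a coordinate axis.
  have key : ∀ z : ℂ, v + z ^ 2 • diagOmega.1.mulVec v +
      z • diagOmega.1.mulVec (diagOmega.1.mulVec v) ∈ U := fun z =>
    U.add_mem (U.add_mem hv (U.smul_mem _ (hU _ hv))) (U.smul_mem _ (hU _ (hU _ hv)))
  have hs : Pi.single i (3 * v i) ∈ U := by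
    rw [e2, e1] at key
    fin_cases i
    · convert key 1 using 1
      ext j
      fin_cases j <;> simp [Matrix.vecHead, Matrix.vecTail] <;> clear * - hw <;> grind
    · convert key omega using 1
      ext j
      fin_cases j <;> simp [Matrix.vecHead, Matrix.vecTail] <;> clear * - hw <;> grind
    · convert key (omega ^ 2) using 1
      ext j
      fin_cases j <;> simp [Matrix.vecHead, Matrix.vecTail] <;> clear * - hw <;> grind
  have := U.smul_mem (3 * v i)⁻¹ hs
  rwa [← Pi.single_smul, smul_eq_mul, inv_mul_cancel₀ (mul_ne_zero three_ne_zero hi)] at this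

/-- The set `s` consists of the indices whose coordinate vectors lie in `U`. Invariance under `C`
kills the entries leading from `s` to its complement. -/
theorem exists_of_invariant {C : SL3} {U : Submodule ℂ (Fin 3 → ℂ)} (h0 : U ≠ ⊥) (h1 : U ≠ ⊤)
    (hC : ∀ v ∈ U, C.1.mulVec v ∈ U) (hD : ∀ v ∈ U, diagOmega.1.mulVec v ∈ U) :
    ∃ s : Fin 3 → Prop, (∃ i, s i) ∧ (∃ i, ¬ s i) ∧
      ∀ i j, s i → ¬ s j → C.1 i j * C.1 j i = 0 := by
  refine ⟨fun i => Pi.single i 1 ∈ U, ?_, ?_, ?_⟩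
  · obtain ⟨v, hv, hv0⟩ := Submodule.exists_mem_ne_zero_of_ne_bot h0
    obtain ⟨i, hi⟩ := Function.ne_iff.1 hv0
    exact ⟨i, single_mem_of_diagOmega hD hv hi⟩
  · by_contra! hc
    refine h1 (eq_top_iff.2 fun v _ => ?_)
    rw [pi_eq_sum_univ v]
    refine sum_mem fun i _ => U.smul_mem _ ?_
    convert hc i using 1
    ext j
    simp [Pi.single_apply, eq_comm]
  · intro i j hi hj
    by_contra hne
    refine hj (single_mem_of_diagOmega hD (hC _ hi) (i := j) ?_)
    rw [Matrix.mulVec_single_one]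
    exact right_ne_zero_of_mul hne

theorem coords_of_reducible {χ : CharVariety} (hχ : χ ∈ componentV2) (hr : χ.IsReducible) :
    ∃ w : ℂ, w ^ 3 = 1 ∧ χ.coords = centerAct w ![2, 2, 2, 2, 1, 1, 1, 1] := by
  obtain ⟨ρ, hρ, hc⟩ := hr
  obtain rfl : ofRep ρ = χ := Subtype.ext hc
  obtain ⟨h1, h2, h3, h4⟩ := tr_of_mem_componentV2 hχ
  obtain ⟨C, hC, g, hg⟩ := exists_conj_triangleRep h1 h2 h3 h4
  obtain ⟨U, hU0, hU1, hUb, hUt⟩ := Rep3.not_isIrred_iff.1 hρ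
  have hinv : ∀ v, g.1.mulVec ((g⁻¹).1.mulVec v) = v := fun v => by
    rw [Matrix.mulVec_mulVec, ← Matrix.SpecialLinearGroup.coe_mul, mul_inv_cancel,
      Matrix.SpecialLinearGroup.coe_one, Matrix.one_mulVec]
  let W : Submodule ℂ (Fin 3 → ℂ) := U.comap (Matrix.toLin' g.1)
  have hW : ∀ γ, ∀ v ∈ W, (hC.rep γ).1.mulVec v ∈ W := by
    intro γ v hv
    have := ρ.mulVec_mem hUb hUt γ _ hv
    change g.1.mulVec ((hC.rep γ).1.mulVec v) ∈ U
    rw [Matrix.mulVec_mulVec, ← Matrix.SpecialLinearGroup.coe_mul,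
      show g * hC.rep γ = ρ γ * g by rw [hg, inv_mul_cancel_right],
      Matrix.SpecialLinearGroup.coe_mul, ← Matrix.mulVec_mulVec]
    exact this
  have hW0 : W ≠ ⊥ := by
    obtain ⟨v, hv, hv0⟩ := Submodule.exists_mem_ne_zero_of_ne_bot hU0
    intro h
    have hm : (g⁻¹).1.mulVec v ∈ W := by
      change g.1.mulVec _ ∈ U
      rwa [hinv]
    rw [h, Submodule.mem_bot] at hm
    exact hv0 (by rw [← hinv v, hm, Matrix.mulVec_zero])
  have hW1 : W ≠ ⊤ := by
    intro h
    refine hU1 (eq_top_iff.2 fun v _ => ?_)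
    have hm : (g⁻¹).1.mulVec v ∈ W := by rw [h]; trivial
    change g.1.mulVec _ ∈ U at hm
    rwa [hinv] at hm
  have hD := hW (t * b⁻¹)
  have hB := hW b
  rw [map_mul, map_inv, hC.rep_t, hC.rep_b, mul_inv_cancel_right] at hD
  rw [hC.rep_b] at hB
  obtain ⟨s, hs, hs', hz⟩ := exists_of_invariant hW0 hW1 hB hD
  have hz' : ∀ i j, ¬ (s i ↔ s j) → C.1 i j * C.1 j i = 0 := by
    intro i j h
    by_cases hi : s i
    · exact hz i j hi (by tauto)
    · rw [mul_comm]
      exact hz j i (by tauto) hi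
  have hcy := isTrianglePair_diagOmega_iff.1 hC
  have hco := coords_triangleRep hC
  rw [← ofRep_eq_of_conj hg] at hco
  have hsurf : (ofRep ρ).coords ∈ surface := hχ
  rw [hco] at hsurf ⊢
  obtain ⟨-, -, s1, s2, -, -⟩ := hsurf
  simp only [Matrix.cons_val] at s1 s2
  have c0 := hcy.c0
  have c1 := hcy.c1
  have c2 := hcy.c2
  have hw := omega_sq
  have h2w := two_mul_omega_add_one_ne_zero
  suffices h : ∃ w : ℂ, w ^ 3 = 1 ∧ SL3.tr (diagOmega * C) = 2 * w ∧
      SL3.tr (diagOmega * C)⁻¹ = 2 * w ^ 2 by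
    obtain ⟨w, hw3, e0, e1⟩ := h
    refine ⟨w, hw3, ?_⟩
    generalize SL3.tr (C⁻¹ * diagOmega * C * diagOmega⁻¹ * C⁻¹) = α at *
    generalize SL3.tr (C⁻¹ * diagOmega * C * diagOmega⁻¹ * C⁻¹)⁻¹ = α' at *
    rw [e0, e1] at s1 s2 ⊢
    -- At y = 2w, ȳ = 2w² the equations read α + ᾱ = 2 and αᾱ = 1.
    have hα : (α - 1) ^ 2 = 0 := by
      linear_combination s2 - (α + 5) * s1 - (8 + 8 * (w ^ 3 + 1) - 4 * (α + 5)) * hw3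
    have hα1 : α = 1 := sub_eq_zero.1 (pow_eq_zero_iff two_ne_zero |>.1 hα)
    have hα2 : α' = 1 := by linear_combination 4 * hw3 - s1 - hα1
    rw [hα1, hα2]
    ext i
    fin_cases i <;> simp [centerAct] <;> grind
  generalize SL3.tr (diagOmega * C) = y at *
  generalize SL3.tr (diagOmega * C)⁻¹ = y' at *
  clear hcy hco s1 s2 hχ hW hg
  -- One index is separated from the other two, so two 2-cycles vanish. These are two linear
  -- equations in y and y² - 3ȳ, and they determine y and ȳ.
  by_cases h01 : s 0 ↔ s 1
  · have h02 : ¬ (s 0 ↔ s 2) := by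
      intro h02
      obtain ⟨i, hi⟩ := hs
      obtain ⟨j, hj⟩ := hs'
      fin_cases i <;> fin_cases j <;> simp at hi hj <;> tauto
    rw [hz' 0 2 h02] at c1
    rw [hz' 1 2 (by tauto)] at c0
    clear * - c0 c1 hw h2w
    exact ⟨omega ^ 2, cube_eq_one_iff.2 (by simp), by grind, by grind⟩
  · by_cases h02 : s 0 ↔ s 2
    · rw [hz' 0 1 h01] at c2
      rw [hz' 1 2 (by tauto)] at c0
      clear * - c0 c2 hw h2w
      exact ⟨omega, omega_pow_three, by grind, by grind⟩
    · rw [hz' 0 1 h01] at c2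
      rw [hz' 0 2 h02] at c1
      clear * - c1 c2 hw h2w
      exact ⟨1, one_pow _, by grind, by grind⟩

end CharVariety

/-- A representation in block form with an irreducible `2`-dimensional block, given by the
eigenspaces of the image of `a` and a transitivity condition for `b`, is partially reducible. -/
theorem Rep3.isPartiallyReducible_of_blocks {ρ : Rep3}
    (h : ∀ γ, ∀ i : Fin 2, (ρ γ).1 0 i.succ = 0 ∧ (ρ γ).1 i.succ 0 = 0) {c d : ℂ} (hcd : c ≠ d)
    (ha : (ρ a).1.submatrix Fin.succ Fin.succ = Matrix.diagonal ![c, d])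
    (hb : ∀ i j : Fin 2, i ≠ j → (ρ b).1 i.succ j.succ ≠ 0) :
    ρ.IsPartiallyReducible := by
  let l : Representation ℂ FigEight ℂ :=
    { toFun := fun γ => (ρ γ).1 0 0 • LinearMap.id
      map_one' := by ext; simp
      map_mul' := fun γ δ => by
        ext
        simp [Matrix.mul_apply, Fin.sum_univ_succ, mul_comm,
          show (ρ γ).1 0 1 = 0 from (h γ 0).1, show (ρ γ).1 0 2 = 0 from (h γ 1).1] }
  let σ : Representation ℂ FigEight (Fin 2 → ℂ) :=
    { toFun := fun γ => Matrix.toLin' ((ρ γ).1.submatrix Fin.succ Fin.succ)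
      map_one' := by
        rw [map_one, Matrix.SpecialLinearGroup.coe_one,
          Matrix.submatrix_one _ (Fin.succ_injective 2), Matrix.toLin'_one]
        rfl
      map_mul' := fun γ δ => by
        rw [Module.End.mul_eq_comp, ← Matrix.toLin'_mul]
        congr 1
        ext i j
        rw [Matrix.submatrix_apply, map_mul, Matrix.SpecialLinearGroup.coe_mul, Matrix.mul_apply,
          Fin.sum_univ_succ, (h γ i).2, zero_mul, zero_add, Matrix.mul_apply]
        rfl }
  have hσ : ∀ γ v, σ γ v = ((ρ γ).1.submatrix Fin.succ Fin.succ).mulVec v := fun _ _ => rfl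
  refine ⟨l, σ, ?_, ⟨Representation.Equiv.mk
    (Fin.consLinearEquiv ℂ (fun _ : Fin 3 => ℂ)).symm fun γ => ?_⟩⟩
  · have : Nontrivial (Subrepresentation σ) :=
      ⟨⊥, ⊤, fun e => bot_ne_top (α := Submodule ℂ (Fin 2 → ℂ))
        (congrArg Subrepresentation.toSubmodule e)⟩
    refine { eq_bot_or_eq_top := fun W => ?_ }
    have hW : ∀ γ, ∀ v ∈ W.toSubmodule,
        ((ρ γ).1.submatrix Fin.succ Fin.succ).mulVec v ∈ W.toSubmodule := fun γ v hv =>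
      W.apply_mem_toSubmodule γ hv
    set U := W.toSubmodule with hU
    have hsingle : ∀ v ∈ U, ∀ i, v i ≠ 0 → Pi.single i 1 ∈ U := by
      have hav : ∀ v : Fin 2 → ℂ, ((ρ a).1.submatrix Fin.succ Fin.succ).mulVec v =
          ![c * v 0, d * v 1] := by
        intro v
        ext j
        rw [ha, Matrix.mulVec_diagonal]
        fin_cases j <;> rfl
      intro v hv i hi
      have h1 := hW a v hv
      rw [hav] at h1
      have hs : Pi.single i ((c - d) * v i) ∈ U := by
        fin_cases i
        · have := U.sub_mem h1 (U.smul_mem d hv)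
          convert this using 1
          ext j
          fin_cases j <;> simp [sub_mul]
        · have := U.sub_mem (U.smul_mem c hv) h1
          convert this using 1
          ext j
          fin_cases j <;> simp [sub_mul]
      have := U.smul_mem ((c - d) * v i)⁻¹ hs
      rwa [← Pi.single_smul, smul_eq_mul, inv_mul_cancel₀ (mul_ne_zero (sub_ne_zero.2 hcd) hi)]
        at this
    by_cases h0 : U = ⊥
    · exact Or.inl (Subrepresentation.toSubmodule_injective h0)
    · refine Or.inr (Subrepresentation.toSubmodule_injective ?_)
      obtain ⟨v, hv, hv0⟩ := Submodule.exists_mem_ne_zero_of_ne_bot h0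
      obtain ⟨i, hi⟩ := Function.ne_iff.1 hv0
      have hi := hsingle v hv i hi
      have hall : ∀ j, Pi.single j 1 ∈ U := by
        intro j
        by_cases hij : j = i
        · rwa [hij]
        · refine hsingle _ (hW b _ hi) j ?_
          rw [Matrix.mulVec_single_one]
          exact hb j i hij
      change U = ⊤
      refine eq_top_iff.2 fun v _ => ?_
      rw [pi_eq_sum_univ v]
      refine sum_mem fun i _ => U.smul_mem _ ?_
      convert hall i using 1
      ext j
      simp [Pi.single_apply, eq_comm]
  · refine LinearMap.ext fun v => Prod.ext ?_ (funext fun i => ?_)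
    · change ((ρ γ).1.mulVec v) 0 = (ρ γ).1 0 0 * v 0
      rw [Matrix.mulVec, dotProduct, Fin.sum_univ_succ,
        Finset.sum_eq_zero fun i _ => by rw [(h γ i).1, zero_mul], add_zero]
    · change ((ρ γ).1.mulVec v) i.succ = ((ρ γ).1.submatrix Fin.succ Fin.succ).mulVec (Fin.tail v) i
      rw [Matrix.mulVec, dotProduct, Fin.sum_univ_succ, (h γ i).2, zero_mul, zero_add]
      rfl

open Complex in
/-- The image of `a` under `tetraRep`. -/
noncomputable def tetraA : SL3 := ⟨!![1, 0, 0; 0, I, 0; 0, 0, -I], by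
  rw [Matrix.det_fin_three]; simp⟩

/-- The image of `b` under `tetraRep`. -/
noncomputable def tetraB : SL3 := ⟨!![1, 0, 0; 0, 0, 1; 0, -1, 0], by
  rw [Matrix.det_fin_three]; simp⟩

open Complex in
/-- The image of `t` under `tetraRep`. -/
noncomputable def tetraT (w : ℂ) (hw : w ^ 3 = 1) : SL3 :=
  ⟨!![w, 0, 0; 0, w * (1 - I) / 2, w * (-1 - I) / 2; 0, w * (1 - I) / 2, w * (1 + I) / 2], by
    rw [Matrix.det_fin_three]
    have := I_sq
    simp
    grind⟩

/-- The sum of a character and the twist by that character of a representation onto the binary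
tetrahedral group. -/
noncomputable def tetraRep (w : ℂ) (hw : w ^ 3 = 1) : Rep3 :=
  lift tetraA tetraB (tetraT w hw)
    (by
      rw [mul_inv_eq_iff_eq_mul]
      apply Subtype.ext
      change (tetraT w hw).1 * tetraA.1 = tetraA.1 * tetraB.1 * (tetraT w hw).1
      have := Complex.I_sq
      ext i j
      fin_cases i <;> fin_cases j <;>
        simp [tetraA, tetraB, tetraT, Matrix.mul_apply, Fin.sum_univ_three] <;> grind)
    (by
      rw [mul_inv_eq_iff_eq_mul]
      apply Subtype.ext
      change (tetraT w hw).1 * tetraB.1 = tetraB.1 * tetraA.1 * tetraB.1 * (tetraT w hw).1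
      have := Complex.I_sq
      ext i j
      fin_cases i <;> fin_cases j <;>
        simp [tetraA, tetraB, tetraT, Matrix.mul_apply, Fin.sum_univ_three] <;> grind)

section tetraRep

variable (w : ℂ) (hw : w ^ 3 = 1)

@[simp] theorem tetraRep_a : tetraRep w hw a = tetraA := lift_a _ _
@[simp] theorem tetraRep_b : tetraRep w hw b = tetraB := lift_b _ _
@[simp] theorem tetraRep_t : tetraRep w hw t = tetraT w hw := lift_t _ _

theorem tetraRep_mem_line (γ : FigEight) (v : Fin 3 → ℂ) (hv : v 1 = 0 ∧ v 2 = 0) :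
    ((tetraRep w hw γ).1.mulVec v) 1 = 0 ∧ ((tetraRep w hw γ).1.mulVec v) 2 = 0 := by
  let U : Submodule ℂ (Fin 3 → ℂ) :=
    LinearMap.ker (LinearMap.proj (R := ℂ) (φ := fun _ : Fin 3 => ℂ) 1) ⊓
      LinearMap.ker (LinearMap.proj (R := ℂ) (φ := fun _ : Fin 3 => ℂ) 2)
  refine (tetraRep w hw).mulVec_mem (U := U) ?_ ?_ γ v hv
  · rintro v ⟨h1, h2⟩
    have h1 : Matrix.vecHead (Matrix.vecTail v) = 0 := h1
    have h2 : Matrix.vecHead (Matrix.vecTail (Matrix.vecTail v)) = 0 := h2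
    constructor <;> simp [tetraB, h1, h2]
  · rintro v ⟨h1, h2⟩
    have h1 : Matrix.vecHead (Matrix.vecTail v) = 0 := h1
    have h2 : Matrix.vecHead (Matrix.vecTail (Matrix.vecTail v)) = 0 := h2
    constructor <;> simp [tetraT, h1, h2]

theorem tetraRep_mem_plane {γ : FigEight} {v : Fin 3 → ℂ} (hv : v 0 = 0) :
    ((tetraRep w hw γ).1.mulVec v) 0 = 0 := by
  let U : Submodule ℂ (Fin 3 → ℂ) :=
    LinearMap.ker (LinearMap.proj (R := ℂ) (φ := fun _ : Fin 3 => ℂ) 0)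
  refine (tetraRep w hw).mulVec_mem (U := U) ?_ ?_ γ v hv
  · intro v h
    have h : Matrix.vecHead v = 0 := h
    simp [tetraB, U, h]
  · intro v h
    have h : Matrix.vecHead v = 0 := h
    simp [tetraT, U, h]

theorem tetraRep_isPartiallyReducible : (tetraRep w hw).IsPartiallyReducible := by
  have hI : Complex.I ≠ -Complex.I := by
    intro h
    have := congrArg Complex.im h
    norm_num at this
  refine Rep3.isPartiallyReducible_of_blocks (c := Complex.I) (d := -Complex.I) ?_ hI ?_ ?_
  · intro γ i
    constructor
    · have := tetraRep_mem_plane w hw (γ := γ) (v := Pi.single i.succ 1)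
        (Pi.single_eq_of_ne (Fin.succ_ne_zero i).symm _)
      rwa [Matrix.mulVec_single_one] at this
    · have := tetraRep_mem_line w hw γ (Pi.single 0 1) (by simp)
      rw [Matrix.mulVec_single_one] at this
      fin_cases i
      · exact this.1
      · exact this.2
  · rw [tetraRep_a]
    ext i j
    fin_cases i <;> fin_cases j <;> simp [tetraA, Matrix.diagonal]
  · rw [tetraRep_b]
    intro i j hij
    fin_cases i <;> fin_cases j <;> simp [tetraB] at hij ⊢

theorem tetraRep_not_isIrred : ¬ (tetraRep w hw).IsIrred := by
  rw [Rep3.not_isIrred_iff]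
  refine ⟨LinearMap.ker (LinearMap.proj (R := ℂ) (φ := fun _ : Fin 3 => ℂ) 0), ?_, ?_,
    fun v hv => tetraRep_mem_plane w hw hv, fun v hv => tetraRep_mem_plane w hw hv⟩
  · intro h
    have : (Pi.single 1 1 : Fin 3 → ℂ) ∈
        LinearMap.ker (LinearMap.proj (R := ℂ) (φ := fun _ : Fin 3 => ℂ) 0) := by simp
    rw [h, Submodule.mem_bot] at this
    simpa using congrFun this 1
  · intro h
    have : (Pi.single 0 1 : Fin 3 → ℂ) ∈
        LinearMap.ker (LinearMap.proj (R := ℂ) (φ := fun _ : Fin 3 => ℂ) 0) := by rw [h]; trivial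
    simp at this

end tetraRep

namespace CharVariety

theorem tetraRep_mem (w : ℂ) (hw : w ^ 3 = 1) : ofRep (tetraRep w hw) ∈ componentV2 ∧
    (ofRep (tetraRep w hw)).coords = centerAct w ![2, 2, 2, 2, 1, 1, 1, 1] := by
  have hI := Complex.I_sq
  have hb : (ofRep (tetraRep w hw)).tr b = 1 := by
    rw [tr_ofRep, tetraRep_b, tr_fin]
    simp [tetraB]
  have hb' : (ofRep (tetraRep w hw)).tr b⁻¹ = 1 := by
    rw [tr_ofRep, map_inv, tetraRep_b, tr_fin, inv_coe_fin]
    simp [tetraB]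
  have ha : (ofRep (tetraRep w hw)).tr a = 1 := by
    rw [tr_ofRep, tetraRep_a, tr_fin]
    simp [tetraA]
  have ha' : (ofRep (tetraRep w hw)).tr a⁻¹ = 1 := by
    rw [tr_ofRep, map_inv, tetraRep_a, tr_fin, inv_coe_fin]
    simp [tetraA]
  have ht : (ofRep (tetraRep w hw)).tr t = 2 * w := by
    rw [tr_ofRep, tetraRep_t, tr_fin]
    simp [tetraT]
    ring
  have ht' : (ofRep (tetraRep w hw)).tr t⁻¹ = 2 * w ^ 2 := by
    rw [tr_ofRep, map_inv, tetraRep_t, tr_fin, inv_coe_fin]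
    simp [tetraT]
    grind
  have hk : (ofRep (tetraRep w hw)).tr (t * b⁻¹) = 0 := by
    rw [tr_ofRep, map_mul, map_inv, tetraRep_t, tetraRep_b, tr_fin,
      Matrix.SpecialLinearGroup.coe_mul, inv_coe_fin]
    simp [tetraT, tetraB, Matrix.mul_apply, Fin.sum_univ_three]
    ring
  have hk' : (ofRep (tetraRep w hw)).tr (t * b⁻¹)⁻¹ = 0 := by
    rw [tr_ofRep, mul_inv_rev, inv_inv, map_mul, map_inv, tetraRep_t, tetraRep_b, tr_fin,
      Matrix.SpecialLinearGroup.coe_mul, inv_coe_fin]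
    simp [tetraT, tetraB, Matrix.mul_apply, Fin.sum_univ_three]
    grind
  have hm := mem_componentV2_of_tr hb hb' hk hk'
  refine ⟨hm, ?_⟩
  obtain ⟨-, -, -, -, hz, hz'⟩ := mem_componentV2.1 hm
  rw [coords, hz, hz', ht, ht', ha, ha', hb, hb']
  ext i
  fin_cases i <;> simp [centerAct] <;> grind

theorem isPartiallyReducible_of_isReducible {χ : CharVariety} (hχ : χ ∈ componentV2)
    (hr : χ.IsReducible) : χ.IsPartiallyReducible := by
  obtain ⟨w, hw, h⟩ := coords_of_reducible hχ hr
  obtain ⟨h1, h2⟩ := tetraRep_mem w hw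
  have : χ = ofRep (tetraRep w hw) := injOn_coords hχ h1 (h.trans h2.symm)
  rw [this]
  exact ⟨_, tetraRep_isPartiallyReducible w hw, rfl⟩

theorem coords_image_reducible : coords '' {χ | χ ∈ componentV2 ∧ χ.IsReducible} =
    {p | ∃ w : ℂ, w ^ 3 = 1 ∧ p = centerAct w ![2, 2, 2, 2, 1, 1, 1, 1]} := by
  ext p
  constructor
  · rintro ⟨χ, ⟨hχ, hr⟩, rfl⟩
    exact coords_of_reducible hχ hr
  · rintro ⟨w, hw, rfl⟩
    obtain ⟨h1, h2⟩ := tetraRep_mem w hw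
    exact ⟨_, ⟨h1, _, tetraRep_not_isIrred w hw, rfl⟩, h2⟩

end CharVariety

/-! ### The surface is the only component over the plane. -/

namespace CharVariety

open MvPolynomial TopologicalSpace

theorem isClosed_setOf_traces_eq : IsClosed
    {χ : CharVariety | χ.tr a = χ.tr a⁻¹ ∧ χ.tr b = χ.tr b⁻¹} := by
  convert (isClosed_eval_eq (X a) (X a⁻¹)).inter (isClosed_eval_eq (X b) (X b⁻¹)) using 1
  ext χ
  simp

theorem isClosed_setOf_tr_eq_one (γ : FigEight) : IsClosed
    {χ : CharVariety | χ.tr γ = 1 ∧ χ.tr γ⁻¹ = 1} := by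
  convert (isClosed_eval_eq (X γ) 1).inter (isClosed_eval_eq (X γ⁻¹) 1) using 1
  ext χ
  simp

theorem traces_eq_or (χ : CharVariety) : (χ.tr a = χ.tr a⁻¹ ∧ χ.tr b = χ.tr b⁻¹) ∨
    (χ.tr a = 1 ∧ χ.tr a⁻¹ = 1) ∨ (χ.tr b = 1 ∧ χ.tr b⁻¹ = 1) := by
  obtain ⟨ρ, rfl⟩ := χ.exists_rep
  obtain ⟨h1, h2, h3, h4⟩ := trace_equations (relation_a ρ) (relation_b ρ)
  simp only [tr_ofRep, map_inv]
  grind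

theorem closure_isIrred_subset : closure {χ : CharVariety | χ.IsIrred} ⊆
    {χ | χ.tr a = χ.tr a⁻¹ ∧ χ.tr b = χ.tr b⁻¹} ∪ {χ | χ.tr a = 1 ∧ χ.tr a⁻¹ = 1} ∪
      componentV2 := by
  refine closure_minimal (fun χ hχ => ?_) ((isClosed_setOf_traces_eq.union
    (isClosed_setOf_tr_eq_one a)).union isClosed_componentV2)
  rcases χ.traces_eq_or with h | h | h
  · exact Or.inl (Or.inl h)
  · exact Or.inl (Or.inr h)
  · exact Or.inr (mem_componentV2_of_isIrred hχ h.1 h.2)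

/-- At y = ȳ = 0 the equations become α + ᾱ = -2 and αᾱ = 5. The point separates the surface from
both other closed pieces, on which α = ᾱ. -/
theorem exists_mem_componentV2_tr_ne : ∃ χ ∈ componentV2, χ.tr a ≠ χ.tr a⁻¹ := by
  have h : (![0, 0, 0, 0, -1 + 2 * Complex.I, -1 - 2 * Complex.I, 1, 1] : Fin 8 → ℂ) ∈
      surface := by
    have := Complex.I_sq
    refine ⟨rfl, rfl, ?_, ?_, ?_, ?_⟩ <;> simp only [Matrix.cons_val] <;> grind
  obtain ⟨χ, hχ, e⟩ := surjOn_coords h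
  have e1 : χ.tr a = -1 + 2 * Complex.I := congrFun e 4
  have e2 : χ.tr a⁻¹ = -1 - 2 * Complex.I := congrFun e 5
  refine ⟨χ, hχ, fun he => ?_⟩
  rw [e1, e2] at he
  have := congrArg Complex.im he
  norm_num at this

/-- Reducible characters on the surface have α = ᾱ = 1, a closed condition that fails somewhere on
it; irreducibility of the surface does the rest. -/
theorem componentV2_subset_closure : componentV2 ⊆ closure {χ | χ.IsIrred} := by
  have h : componentV2 ⊆ closure {χ | χ.IsIrred} ∪ {χ | χ.tr a = 1 ∧ χ.tr a⁻¹ = 1} := by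
    intro χ hχ
    obtain ⟨ρ, rfl⟩ := χ.exists_rep
    by_cases hρ : ρ.IsIrred
    · exact Or.inl (subset_closure ⟨ρ, hρ, rfl⟩)
    · obtain ⟨w, -, hw⟩ := coords_of_reducible hχ ⟨ρ, hρ, rfl⟩
      exact Or.inr ⟨congrFun hw 4, congrFun hw 5⟩
  refine (isPreirreducible_iff_isClosed_union_isClosed.1 isIrreducible_componentV2.isPreirreducible
    _ _ isClosed_closure (isClosed_setOf_tr_eq_one a) h).resolve_right fun h => ?_
  obtain ⟨χ, hχ, hne⟩ := exists_mem_componentV2_tr_ne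
  exact hne ((h hχ).1.trans (h hχ).2.symm)

theorem subset_componentV2 {Z : Set CharVariety} (hZ : IsPreirreducible Z)
    (hc : Z ⊆ closure {χ | χ.IsIrred}) (h : componentV2 ⊆ Z) : Z ⊆ componentV2 := by
  obtain ⟨χ, hχ, hne⟩ := exists_mem_componentV2_tr_ne
  refine (isPreirreducible_iff_isClosed_union_isClosed.1 hZ _ _ (isClosed_setOf_traces_eq.union
    (isClosed_setOf_tr_eq_one a)) isClosed_componentV2
    (hc.trans closure_isIrred_subset)).resolve_left fun hl => ?_
  rcases hl (h hχ) with h | h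
  · exact hne h.1
  · exact hne (h.1.trans h.2.symm)

theorem isV2_componentV2 : IsV2 componentV2 :=
  ⟨⟨⟨isIrreducible_componentV2, componentV2_subset_closure⟩,
    fun _ hZ h => subset_componentV2 hZ.1.isPreirreducible hZ.2 h⟩,
    fun _ hχ => ⟨hχ.1, hχ.2.1⟩⟩

/-- In a Noetherian space, a maximal irreducible subset of the closure of `S` that is contained in
a set `P` is contained in the closure of `S ∩ P`. -/
theorem subset_closure_inter_of_maximal {α : Type*} [TopologicalSpace α] [NoetherianSpace α]
    {S P V : Set α}
    (hV : Maximal (fun Z => IsIrreducible Z ∧ Z ⊆ closure S) V) (hVP : V ⊆ P) :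
    V ⊆ closure (S ∩ P) := by
  obtain ⟨F, hF, hFc, hFi, hFU⟩ :=
    NoetherianSpace.exists_finite_set_isClosed_irreducible (isClosed_closure (s := S))
  have hfin : {Y ∈ F | ¬ Y ⊆ P}.Finite := hF.subset fun _ h => h.1
  have hcl : IsClosed (⋃₀ {Y ∈ F | ¬ Y ⊆ P}) := by
    rw [Set.sUnion_eq_biUnion]
    exact hfin.isClosed_biUnion fun Y hY => hFc Y hY.1
  -- A point of `S` outside `P` lies on a piece not contained in `P`. If `V` were inside such a
  -- piece, maximality would put the piece inside `V`, hence inside `P`.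
  have hcover : closure S ⊆ closure (S ∩ P) ∪ ⋃₀ {Y ∈ F | ¬ Y ⊆ P} := by
    refine closure_minimal (fun x hx => ?_) (isClosed_closure.union hcl)
    by_cases hxP : x ∈ P
    · exact Or.inl (subset_closure ⟨hx, hxP⟩)
    · have : x ∈ ⋃₀ F := hFU ▸ subset_closure hx
      obtain ⟨Y, hY, hxY⟩ := this
      exact Or.inr ⟨Y, ⟨hY, fun h => hxP (h hxY)⟩, hxY⟩
  refine (isPreirreducible_iff_isClosed_union_isClosed.1 hV.1.1.isPreirreducible _ _
    isClosed_closure hcl (hV.1.2.trans hcover)).resolve_right fun h => ?_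
  obtain ⟨Y, hY, hVY⟩ := (isIrreducible_iff_sUnion_isClosed.1 hV.1.1) hfin.toFinset
    (fun Y hY => hFc Y (hfin.mem_toFinset.1 hY).1) (by rwa [hfin.coe_toFinset])
  obtain ⟨hYF, hYP⟩ := hfin.mem_toFinset.1 hY
  exact hYP ((hV.2 ⟨hFi Y hYF, hFU ▸ Set.subset_sUnion_of_mem hYF⟩ hVY).trans hVP)

theorem IsV2.eq_componentV2 {V : Set CharVariety} (hV : IsV2 V) : V = componentV2 := by
  have h : V ⊆ componentV2 :=
    (subset_closure_inter_of_maximal hV.1 hV.2).trans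
      (closure_minimal (fun χ hχ => mem_componentV2_of_isIrred hχ.1 hχ.2.1 hχ.2.2)
        isClosed_componentV2)
  exact h.antisymm (hV.1.2 isV2_componentV2.1.1 h)

end CharVariety

end FigEight

open FigEight CharVariety MvPolynomial in
/-- In `p : Fin 8 → ℂ` and in the polynomials, the indices `0, …, 7` stand for
`y, ȳ, z, z̄, α, ᾱ, β, β̄`. -/
theorem proposition6p1 :
    ∃ V : Set CharVariety,
      -- `V` is the component `V₂`: there is exactly one such component
      (IsV2 V ∧ ∀ V' : Set CharVariety, IsV2 V' → V' = V) ∧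
      -- the coordinates identify `V` with the set of all solutions of the equations
      Set.BijOn coords V
        {p | p 6 = 1 ∧ p 7 = 1 ∧ p 0 * p 1 = p 4 + p 5 + 2 ∧
          p 0 ^ 3 + p 1 ^ 3 = p 4 * p 5 + 5 * p 4 + 5 * p 5 + 5 ∧
          p 2 = p 0 ^ 2 - p 1 ∧ p 3 = p 1 ^ 2 - p 0} ∧
      -- every character that satisfies the equations lies in `V`
      (∀ χ : CharVariety,
        (χ.tr b = 1 ∧ χ.tr b⁻¹ = 1 ∧
          χ.tr t * χ.tr t⁻¹ = χ.tr a + χ.tr a⁻¹ + 2 ∧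
          χ.tr t ^ 3 + χ.tr t⁻¹ ^ 3 =
            χ.tr a * χ.tr a⁻¹ + 5 * χ.tr a + 5 * χ.tr a⁻¹ + 5 ∧
          χ.tr (t * a⁻¹ * t * a) = χ.tr t ^ 2 - χ.tr t⁻¹ ∧
          χ.tr (a⁻¹ * t⁻¹ * a * t⁻¹) = χ.tr t⁻¹ ^ 2 - χ.tr t) → χ ∈ V) ∧
      -- the equations generate the ideal of all relations between the coordinates on `V`
      vanishingIdeal ℂ (coords '' V) =
        Ideal.span {X 6 - 1, X 7 - 1, X 0 * X 1 - (X 4 + X 5 + 2),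
          X 0 ^ 3 + X 1 ^ 3 - (X 4 * X 5 + 5 * X 4 + 5 * X 5 + 5),
          X 2 - (X 0 ^ 2 - X 1), X 3 - (X 1 ^ 2 - X 0)} ∧
      -- the ninth coordinate `η` on `V`
      (∀ χ ∈ V, χ.eta = χ.tr t⁻¹ ^ 3 - 3 * (χ.tr a + χ.tr a⁻¹ + 1)) ∧
      -- the reducible characters in `V`
      coords '' {χ | χ ∈ V ∧ χ.IsReducible} =
        {p | ∃ w : ℂ, w ^ 3 = 1 ∧ p = centerAct w ![2, 2, 2, 2, 1, 1, 1, 1]} ∧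
      (∀ χ ∈ V, χ.IsReducible → χ.IsPartiallyReducible) := by
  refine ⟨componentV2, ⟨isV2_componentV2, fun V' h => h.eq_componentV2⟩, bijOn_coords,
    fun χ h => mem_componentV2.2 h, ?_, fun χ h => eta_eq h, coords_image_reducible,
    fun χ h hr => isPartiallyReducible_of_isReducible h hr⟩
  rw [bijOn_coords.image_eq]
  exact vanishingIdeal_surface
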